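/- **Setting.** Let $p\ge 1$ and $B,C,\tau>0$. Let $\theta^\star\in\mathbb R^p$ be unknown with $\|\theta^\star\|_2\le B$, and let $(\mathcal X_t)_{t\ge1}$ be a fixed (oblivious) sequence of decision sets contained in the closed Euclidean unit ball of $\mathbb R^p$. In round $t$ the agent picks $X_t\in\mathcal X_t$ and observes $Y_t=\langle\theta^\star,X_t\rangle+\varepsilon_t$. The regret is $\mathrm{Reg}(T)=\sum_{t=1}^T\sup_{x\in\mathcal X_t}\langle x-X_t,\theta^\star\rangle$. *Noise (geometric mixing).* Let $\mathcal F_t=\sigma(\varepsilon_1,\dots,\varepsilon_t)$ and $\phi_d=Ce^{-d/\tau}$. Every $\varepsilon_t$ is centred and $1$-sub-Gaussian, and for all $d\ge1$, $t>d$ and $l\in\mathbb R$, almost surely $$\bigl|\mathbb E[\varepsilon_t\mid\mathcal F_{t-d}]\bigr|\le\phi_d,\qquad \mathbb E\bigl[e^{l(\varepsilon_t-\mathbb E[\varepsilon_t\mid\mathcal F_{t-d}])}\bigm|\mathcal F_{t-d}\bigr]\le e^{l^2/2}.$$ *Algorithm (Mixing-LinUCB, with delay $d\ge1$, confidence level $\delta\in(0,1)$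 and $\lambda=1/B^2$).* For $t\ge1$ let $\widehat\theta_t$ be a minimiser of $\sum_{s=1}^t(\langle\theta,X_s\rangle-Y_s)^2$ over $\|\theta\|_2\le B$, let $V_t=\sum_{s=1}^tX_sX_s^\top+\lambda\,\mathrm{Id}$, $\|v\|_{V_t}^2=v^\top V_tv$, and let $\mathcal C_t$ be the set of all $\theta$ with $\|\theta\|_2\le B$ and $$\tfrac12\|\theta-\widehat\theta_t\|_{V_t}^2\le\tfrac{dp}{2}\log\tfrac{(B+1)^2e\max(dp,\,t+d)}{dp}+2\lambda B^2+t\phi_d(B+1)+d\log\tfrac d\delta .$$ The arms $X_1,\dots,X_d$ are arbitrary and deterministic; for $t>d$, $X_t$ maximises $x\mapsto\max_{\theta\in\mathcal C_{t-d}}\langle x,\theta\rangle$ over $x\in\mathcal X_t$. Ties are broken in such a way that $X_t$ is $\mathcal F_{t-d}$-measurable. *Gap.* Let $\Delta>0$ be such that in each round $t\le T$ there is an optimal arm $X_t^\star\in\mathcal X_t$ with $\langle X_t^\star-x,\theta^\star\rangle\ge\Delta$ for every $x\in\mathcal X_t$, $x\ne X_t^\star$. **Result.** There is a universal constant $K>0$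 such that for all $p,B,C,\tau$ there is a $T_0$ (depending only on $p,B,C,\tau$) such that for every horizon $T\ge T_0$, every $\delta\in(0,1)$, every $\Delta>0$ and every problem as above, Mixing-LinUCB run with delay $d=\lceil\tau\log\frac{BCT}{p}\rceil$ satisfies, with probability at least $1-\delta$, $$\mathrm{Reg}(T)\le K\cdot\frac{8\tau p}{\Delta}\Bigl(\log\frac{BCT}{p}\Bigr)^2\log\Bigl(1+\frac{B^2T}{p\tau\log\frac{BCT}{p}}\Bigr)\Bigl(\frac p2\log\frac{T}{p\tau}+\log\frac{\tau\log\frac{BCT}{p}}{\delta}\Bigr).$$ For fixed $p,B,C,\tau,\Delta,\delta$ the right-hand side is polylogarithmic in $T$: it is $O((\log T)^4)$ as $T\to\infty$. -/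

import Mathlib

open MeasureTheory ProbabilityTheory Filter Asymptotics
open scoped NNReal Matrix

noncomputable section

namespace MixingBandit

/-- The `σ`-field `σ(ε₁, …, εₜ)` generated by the first `t` noise variables (trivial for `t = 0`).
Rounds are numbered from `1`; the value `ε 0` is never used. -/
abbrev noiseSigma {Ω : Type*} (ε : ℕ → Ω → ℝ) (t : ℕ) : MeasurableSpace Ω :=
  ⨆ s ∈ Set.Icc 1 t, MeasurableSpace.comap (ε s) inferInstance

/-- The noise `(εₜ)` (`t ≥ 1`) is `(σ, φ)`-mixing sub-Gaussian: every `εₜ` is centred and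
`σ`-sub-Gaussian and, for every lag `d ≥ 1` and every `t > d`, the conditional mean of `εₜ` given
`σ(ε₁, …, ε_{t-d})` is at most `φ d` in absolute value, and `εₜ` minus that conditional mean is
conditionally `σ`-sub-Gaussian. The lag `d = 0`, which would force `|εₜ| ≤ φ 0`, is not required. -/
structure IsMixingSubGaussian {Ω : Type*} [MeasurableSpace Ω] (μ : Measure Ω)
    (σ : ℝ≥0) (φ : ℕ → ℝ) (ε : ℕ → Ω → ℝ) : Prop where
  coeff_nonneg : ∀ d, 0 ≤ φ d
  coeff_antitone : Antitone φ
  measurable : ∀ t, 1 ≤ t → Measurable (ε t)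
  centred : ∀ t, 1 ≤ t → Integrable (ε t) μ ∧ ∫ ω, ε t ω ∂μ = 0
  subGaussian : ∀ t, 1 ≤ t → HasSubgaussianMGF (ε t) (σ ^ 2) μ
  cond_mean : ∀ d t, 1 ≤ d → d < t →
    ∀ᵐ ω ∂μ, |(μ[ε t | noiseSigma ε (t - d)]) ω| ≤ φ d
  cond_subGaussian : ∀ d t, 1 ≤ d → d < t → ∀ l : ℝ,
    ∀ᵐ ω ∂μ,
      (μ[fun ω' => Real.exp (l * (ε t ω' - (μ[ε t | noiseSigma ε (t - d)]) ω')) |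
          noiseSigma ε (t - d)]) ω
        ≤ Real.exp (l ^ 2 * (σ : ℝ) ^ 2 / 2)

/-- The geometric mixing coefficients `φ d = C exp (-d / τ)`. -/
def geometricCoeff (C τ : ℝ) (d : ℕ) : ℝ := C * Real.exp (-(d : ℝ) / τ)

variable {p : ℕ}

/-- The regularised feature-covariance matrix `Vₜ = ∑_{s ≤ t} Xₛ Xₛᵀ + lam Id`. -/
def designMatrix (lam : ℝ) (x : ℕ → EuclideanSpace ℝ (Fin p)) (t : ℕ) :
    Matrix (Fin p) (Fin p) ℝ :=
  (∑ s ∈ Finset.Icc 1 t, Matrix.vecMulVec (x s).ofLp (x s).ofLp) + lam • 1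

/-- The squared norm `‖v‖_V² = vᵀ V v`. -/
def matrixNormSq (V : Matrix (Fin p) (Fin p) ℝ) (v : EuclideanSpace ℝ (Fin p)) : ℝ :=
  v.ofLp ⬝ᵥ (V *ᵥ v.ofLp)

/-- `θhat` minimises `∑_{s ≤ t} (⟨θ, xₛ⟩ - yₛ)²` over the closed ball of radius `B`. -/
def IsLeastSquares (B : ℝ) (x : ℕ → EuclideanSpace ℝ (Fin p)) (y : ℕ → ℝ) (t : ℕ)
    (θhat : EuclideanSpace ℝ (Fin p)) : Prop :=
  θhat ∈ Metric.closedBall 0 B ∧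
    IsMinOn (fun θ : EuclideanSpace ℝ (Fin p) =>
      ∑ s ∈ Finset.Icc 1 t, (inner ℝ θ (x s) - y s) ^ 2) (Metric.closedBall 0 B) θhat

/-- The confidence set `Cₜ`, centred at the estimator `θhat`, built from the mixing coefficients
`φ`, the regularisation `lam`, the confidence level `δ` and the delay `d`. -/
def confidenceSet (φ : ℕ → ℝ) (B lam δ : ℝ) (d : ℕ) (x : ℕ → EuclideanSpace ℝ (Fin p))
    (θhat : EuclideanSpace ℝ (Fin p)) (t : ℕ) : Set (EuclideanSpace ℝ (Fin p)) :=
  {θ | θ ∈ Metric.closedBall 0 B ∧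
    1 / 2 * matrixNormSq (designMatrix lam x t) (θ - θhat) ≤
      (d : ℝ) * p / 2 *
          Real.log ((B + 1) ^ 2 * Real.exp 1 * max ((d : ℝ) * p) ((t : ℝ) + d) / ((d : ℝ) * p))
        + 2 * lam * B ^ 2 + t * φ d * (B + 1) + d * Real.log (d / δ)}

/-- The upper confidence bound `max_{θ ∈ S} ⟨x, θ⟩`. -/
def ucb (S : Set (EuclideanSpace ℝ (Fin p))) (x : EuclideanSpace ℝ (Fin p)) : ℝ :=
  sSup ((fun θ => inner ℝ x θ) '' S)

/-- The reward `Yₜ = ⟨θ⋆, Xₜ⟩ + εₜ`. -/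
def reward {Ω : Type*} (ε : ℕ → Ω → ℝ) (θstar : EuclideanSpace ℝ (Fin p))
    (X : ℕ → Ω → EuclideanSpace ℝ (Fin p)) (t : ℕ) (ω : Ω) : ℝ :=
  inner ℝ θstar (X t ω) + ε t ω

/-- `X` is the sequence of arms played by a (non-randomised) run of Mixing-LinUCB with delay `d`.
The arm `Xₜ` is determined by the noise of the first `t - d` rounds; in particular the arms of the
first `d` rounds are arbitrary but deterministic (for `t ≤ d` the natural-number difference `t - d`
is `0`). From round `d + 1` on, the arm maximises the upper confidence bound of `C_{t-d}`.
The minimisers `θhat` and the maximising arms need not be unique; any choice is allowed. -/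
structure IsMixingLinUCB {Ω : Type*} (ε : ℕ → Ω → ℝ) (θstar : EuclideanSpace ℝ (Fin p))
    (𝒳 : ℕ → Set (EuclideanSpace ℝ (Fin p))) (φ : ℕ → ℝ) (B lam δ : ℝ) (d : ℕ)
    (X : ℕ → Ω → EuclideanSpace ℝ (Fin p)) : Prop where
  mem : ∀ t, 1 ≤ t → ∀ ω, X t ω ∈ 𝒳 t
  adapted : ∀ t, 1 ≤ t → Measurable[noiseSigma ε (t - d)] (X t)
  optimistic : ∃ θhat : ℕ → Ω → EuclideanSpace ℝ (Fin p),
    (∀ t, 1 ≤ t → ∀ ω, IsLeastSquares B (fun s => X s ω) (fun s => reward ε θstar X s ω) t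
      (θhat t ω)) ∧
    ∀ t, d < t → ∀ ω,
      IsMaxOn (ucb (confidenceSet φ B lam δ d (fun s => X s ω) (θhat (t - d) ω) (t - d)))
        (𝒳 t) (X t ω)

/-- The regret `∑_{t ≤ T} sup_{x ∈ 𝒳ₜ} (⟨x, θ⋆⟩ - ⟨xₜ, θ⋆⟩)` of the arms `x₁, …, x_T`. -/
def regret (θstar : EuclideanSpace ℝ (Fin p)) (𝒳 : ℕ → Set (EuclideanSpace ℝ (Fin p)))
    (x : ℕ → EuclideanSpace ℝ (Fin p)) (T : ℕ) : ℝ :=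
  ∑ t ∈ Finset.Icc 1 T, sSup ((fun a => inner ℝ a θstar - inner ℝ (x t) θstar) '' 𝒳 t)

/-- In each of the rounds `1, …, T` there is an arm whose expected reward exceeds the expected
reward of every other arm by at least `Δ`. -/
def HasGap (θstar : EuclideanSpace ℝ (Fin p)) (𝒳 : ℕ → Set (EuclideanSpace ℝ (Fin p)))
    (T : ℕ) (Δ : ℝ) : Prop :=
  ∀ t ∈ Finset.Icc 1 T, ∃ a ∈ 𝒳 t, ∀ x ∈ 𝒳 t, x ≠ a → Δ ≤ inner ℝ (a - x) θstar

/-- The gap-dependent rate under geometric mixing. -/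
def geometricGapRate (p : ℕ) (B C τ Δ δ : ℝ) (T : ℕ) : ℝ :=
  8 * τ * p / Δ * Real.log (B * C * T / p) ^ 2 *
    Real.log (1 + B ^ 2 * T / (p * τ * Real.log (B * C * T / p))) *
    (p / 2 * Real.log (T / (p * τ)) + Real.log (τ * Real.log (B * C * T / p) / δ))

end MixingBandit

end

/-! The noise is dependent, but rounds at distance `d` are almost independent, and the delayed
algorithm plays an arm that is known `d` rounds ahead. Split the rounds into the `d` residue classes
modulo `d`. Along one class, the noise minus its conditional mean given the past of that class is a
conditionally sub-Gaussian martingale difference, and the arms are predictable. A Gaussian mixture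
of exponential supermartingales and Ville's inequality then bound the log-likelihood ratio uniformly
in time and in the parameter (`measure_exists_lt_mixtureExponent_le`). A union bound over the
classes at level `δ / d`, together with first-order optimality of least squares, puts `θstar` in
every confidence set (`mem_confidenceSet`). The conditional means cost a bias of order `t * φ d`,
which stays bounded up to the horizon because `d ≥ τ log (BCT/p)`.

On that event, optimism bounds the squared regret of a late round by `8β` times the squared norm of
its arm in the inverse of a design matrix that is `d` rounds old. The gap turns regret into squared
regret, since a nonzero regret `r` satisfies `Δ r ≤ r²`. The sum of the stale norms is handled by
`sum_delayed_potential_le`: replacing the old inverse by the current one costs a trace difference,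
and these differences add up to at most `d p / λ`.

For fixed parameters the resulting bound has order `(log T)³`, while the stated rate has order `(log
T)⁴`. The spare logarithm absorbs all constants for large `T`, so `K = 1` works. -/

namespace MixingBandit

/-! ### Quadratic forms of positive definite matrices and their inverses -/

section LinearAlgebra

variable {n : Type*} [Fintype n] [DecidableEq n]

omit [DecidableEq n] in
lemma dotProduct_mulVec_symm {V : Matrix n n ℝ} (hV : V.IsHermitian) (x y : n → ℝ) :
    x ⬝ᵥ (V *ᵥ y) = y ⬝ᵥ (V *ᵥ x) := by
  have h : Vᵀ = V := by simpa [Matrix.IsHermitian] using hV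
  rw [Matrix.dotProduct_mulVec, ← Matrix.mulVec_transpose, h, dotProduct_comm]

lemma mulVec_inv_mulVec {V : Matrix n n ℝ} (hV : V.PosDef) (x : n → ℝ) :
    V *ᵥ (V⁻¹ *ᵥ x) = x := by
  rw [Matrix.mulVec_mulVec, Matrix.mul_nonsing_inv _ ((Matrix.isUnit_iff_isUnit_det _).1 hV.isUnit),
    Matrix.one_mulVec]

omit [DecidableEq n] in
lemma quadForm_nonneg {V : Matrix n n ℝ} (hV : V.PosSemidef) (x : n → ℝ) :
    0 ≤ x ⬝ᵥ (V *ᵥ x) := by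
  simpa using hV.dotProduct_mulVec_nonneg x

/-- The Cauchy-Schwarz inequality for the dual norms of `V` and `V⁻¹`. -/
lemma sq_dotProduct_le_quadForm_inv_mul {V : Matrix n n ℝ} (hV : V.PosDef) (x v : n → ℝ) :
    (x ⬝ᵥ v) ^ 2 ≤ (x ⬝ᵥ (V⁻¹ *ᵥ x)) * (v ⬝ᵥ (V *ᵥ v)) := by
  rcases eq_or_ne v 0 with rfl | hv
  · simp
  have hpos : 0 < v ⬝ᵥ (V *ᵥ v) := by simpa using hV.dotProduct_mulVec_pos hv
  set w := V⁻¹ *ᵥ x with hw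
  have hVw : V *ᵥ w = x := mulVec_inv_mulVec hV x
  set q := v ⬝ᵥ (V *ᵥ v) with hq
  set c := x ⬝ᵥ v with hc
  have h0 := quadForm_nonneg hV.posSemidef (q • w - c • v)
  have e1 : w ⬝ᵥ (V *ᵥ v) = c := by
    rw [dotProduct_mulVec_symm hV.1, hVw, dotProduct_comm]
  have e2 : (q • w - c • v) ⬝ᵥ (V *ᵥ (q • w - c • v)) = q * (q * (x ⬝ᵥ w) - c ^ 2) := by
    simp only [Matrix.mulVec_sub, Matrix.mulVec_smul, hVw, sub_dotProduct, dotProduct_sub,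
      smul_dotProduct, dotProduct_smul, smul_eq_mul, e1, ← hq, dotProduct_comm w x,
      dotProduct_comm v x, ← hc]
    ring
  rw [e2] at h0
  nlinarith [nonneg_of_mul_nonneg_right h0 hpos]

/-- Inversion is antitone for the Loewner order. -/
lemma quadForm_inv_antitone {S V : Matrix n n ℝ} (hS : S.PosDef) (hV : V.PosDef)
    (hle : ∀ u, u ⬝ᵥ (S *ᵥ u) ≤ u ⬝ᵥ (V *ᵥ u)) (y : n → ℝ) :
    y ⬝ᵥ (V⁻¹ *ᵥ y) ≤ y ⬝ᵥ (S⁻¹ *ᵥ y) := by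
  -- With `a = yᵀV⁻¹y` and `b = yᵀS⁻¹y`, Cauchy-Schwarz at `v = V⁻¹y` gives `a² ≤ b · vᵀSv ≤ b ·
  -- vᵀVv = b a`.
  have h1 := sq_dotProduct_le_quadForm_inv_mul hS y (V⁻¹ *ᵥ y)
  have h2 := hle (V⁻¹ *ᵥ y)
  rw [mulVec_inv_mulVec hV, dotProduct_comm _ y] at h2
  have h3 := quadForm_nonneg hV.inv.posSemidef y
  have h4 := quadForm_nonneg hS.inv.posSemidef y
  by_contra! h
  nlinarith [mul_le_mul_of_nonneg_left h2 h4]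

omit [DecidableEq n] in
lemma quadForm_le_trace {A : Matrix n n ℝ} (hA : A.PosSemidef) {x : n → ℝ} (hx : x ⬝ᵥ x ≤ 1) :
    x ⬝ᵥ (A *ᵥ x) ≤ A.trace := by
  obtain ⟨m, v, rfl⟩ := Matrix.posSemidef_iff_eq_sum_vecMulVec.1 hA
  rw [Matrix.sum_mulVec, dotProduct_sum, Matrix.trace_sum]
  refine Finset.sum_le_sum fun j _ => ?_
  have e1 : x ⬝ᵥ (Matrix.vecMulVec (v j) (star (v j)) *ᵥ x) = (∑ i, v j i * x i) ^ 2 := by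
    rw [star_trivial, Matrix.vecMulVec_mulVec, op_smul_eq_smul, dotProduct_smul, smul_eq_mul,
      dotProduct_comm x, sq]
    rfl
  have e2 : (Matrix.vecMulVec (v j) (star (v j))).trace = ∑ i, v j i ^ 2 := by
    simp [Matrix.trace, Matrix.vecMulVec_apply, sq]
  have e3 : ∑ i, x i ^ 2 = x ⬝ᵥ x := by simp [dotProduct, sq]
  rw [e1, e2]
  refine (Finset.sum_mul_sq_le_sq_mul_sq _ _ _).trans ?_
  rw [e3]
  exact mul_le_of_le_one_right (Finset.sum_nonneg fun i _ => sq_nonneg _) hx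

/-- `S⁻¹ - V⁻¹` is positive semidefinite, so on the unit ball its form is at most its trace. With
`S` the stale and `V` the current design matrix, the price of the delay becomes a difference of
traces, which can be summed. -/
lemma quadForm_inv_sub_le_trace {S V : Matrix n n ℝ} (hS : S.PosDef) (hV : V.PosDef)
    (hle : ∀ u, u ⬝ᵥ (S *ᵥ u) ≤ u ⬝ᵥ (V *ᵥ u)) {x : n → ℝ} (hx : x ⬝ᵥ x ≤ 1) :
    x ⬝ᵥ (S⁻¹ *ᵥ x) ≤ x ⬝ᵥ (V⁻¹ *ᵥ x) + (S⁻¹.trace - V⁻¹.trace) := by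
  have hA : (S⁻¹ - V⁻¹).PosSemidef := by
    refine Matrix.PosSemidef.of_dotProduct_mulVec_nonneg (hS.inv.1.sub hV.inv.1) fun y => ?_
    simpa [Matrix.sub_mulVec] using quadForm_inv_antitone hS hV hle y
  have := quadForm_le_trace hA hx
  rw [Matrix.sub_mulVec, dotProduct_sub, Matrix.trace_sub] at this
  linarith

/-- By the matrix determinant lemma the left side is `1 - det V / det W` for the updated matrix `W`,
and `log y ≤ y - 1` concludes. Using the inverse after the update avoids any truncation of the
summands at `1`. -/
lemma quadForm_inv_le_log_det {V : Matrix n n ℝ} (hV : V.PosDef) (x : n → ℝ) :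
    x ⬝ᵥ ((V + Matrix.vecMulVec x x)⁻¹ *ᵥ x) ≤
      Real.log (V + Matrix.vecMulVec x x).det - Real.log V.det := by
  set W := V + Matrix.vecMulVec x x with hW
  have hWpos : W.PosDef := hV.add_posSemidef (by simpa using Matrix.posSemidef_vecMulVec_self_star x)
  have hdet : V.det = W.det * (1 - x ⬝ᵥ (W⁻¹ *ᵥ x)) := by
    have hV' : V = W + Matrix.replicateCol Unit (-x) * Matrix.replicateRow Unit x := by
      rw [hW, ← Matrix.vecMulVec_eq, Matrix.neg_vecMulVec]
      abel
    have hu : IsUnit W.det := (Matrix.isUnit_iff_isUnit_det _).1 hWpos.isUnit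
    rw [hV', Matrix.det_add_replicateCol_mul_replicateRow hu]
    congr 1
    rw [← Matrix.replicateRow_vecMul, Matrix.det_unique, Matrix.add_apply, Matrix.one_apply_eq,
      Matrix.replicateRow_mul_replicateCol_apply, ← Matrix.dotProduct_mulVec, Matrix.mulVec_neg,
      dotProduct_neg, sub_eq_add_neg]
  have h1 : 0 < V.det := hV.det_pos
  have h2 : 0 < W.det := hWpos.det_pos
  have h3 : 0 < 1 - x ⬝ᵥ (W⁻¹ *ᵥ x) := by
    rw [hdet] at h1
    exact (pos_iff_pos_of_mul_pos h1).1 h2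
  rw [hdet, Real.log_mul h2.ne' h3.ne']
  have := Real.log_le_sub_one_of_pos h3
  linarith

end LinearAlgebra

/-! ### The elliptic potential under delay -/

section EllipticPotential

variable {p : ℕ} {lam : ℝ} {x : ℕ → EuclideanSpace ℝ (Fin p)}

lemma designMatrix_zero : designMatrix lam x 0 = lam • 1 := by
  simp [designMatrix]

lemma designMatrix_succ (t : ℕ) :
    designMatrix lam x (t + 1) =
      designMatrix lam x t + Matrix.vecMulVec (x (t + 1)).ofLp (x (t + 1)).ofLp := by
  rw [designMatrix, designMatrix, Finset.sum_Icc_succ_top (by omega)]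
  abel

lemma designMatrix_posDef (hlam : 0 < lam) (t : ℕ) : (designMatrix lam x t).PosDef := by
  induction t with
  | zero => rw [designMatrix_zero]; exact Matrix.PosDef.one.smul hlam
  | succ t ih =>
    rw [designMatrix_succ]
    exact ih.add_posSemidef (by simpa using Matrix.posSemidef_vecMulVec_self_star (x (t + 1)).ofLp)

lemma dotProduct_eq_inner (a b : EuclideanSpace ℝ (Fin p)) : a.ofLp ⬝ᵥ b.ofLp = inner ℝ a b := by
  rw [EuclideanSpace.inner_eq_star_dotProduct, star_trivial, dotProduct_comm]

lemma matrixNormSq_designMatrix (t : ℕ) (v : EuclideanSpace ℝ (Fin p)) :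
    matrixNormSq (designMatrix lam x t) v =
      ∑ s ∈ Finset.Icc 1 t, inner ℝ v (x s) ^ 2 + lam * ‖v‖ ^ 2 := by
  rw [matrixNormSq, designMatrix, Matrix.add_mulVec, dotProduct_add, Matrix.sum_mulVec,
    dotProduct_sum, Matrix.smul_mulVec, Matrix.one_mulVec, dotProduct_smul, dotProduct_eq_inner,
    real_inner_self_eq_norm_sq, smul_eq_mul]
  congr 1
  refine Finset.sum_congr rfl fun s _ => ?_
  rw [Matrix.vecMulVec_mulVec, op_smul_eq_smul, dotProduct_smul, dotProduct_eq_inner,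
    dotProduct_eq_inner, smul_eq_mul, sq, real_inner_comm]

lemma matrixNormSq_designMatrix_mono {s t : ℕ} (hst : s ≤ t) (v : EuclideanSpace ℝ (Fin p)) :
    matrixNormSq (designMatrix lam x s) v ≤ matrixNormSq (designMatrix lam x t) v := by
  rw [matrixNormSq_designMatrix, matrixNormSq_designMatrix]
  gcongr

/-- The entrywise (Leibniz) bound is crude, but only the logarithm matters: the factorial adds a
constant depending on `p`, absorbed for large horizons. -/
lemma det_designMatrix_le (hlam : 0 < lam) (hx : ∀ t, 1 ≤ t → ‖x t‖ ≤ 1) (t : ℕ) :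
    (designMatrix lam x t).det ≤ p.factorial * (lam + t) ^ p := by
  have hent : ∀ i j, |designMatrix lam x t i j| ≤ lam + t := by
    intro i j
    rw [designMatrix, Matrix.add_apply, Matrix.sum_apply, add_comm]
    refine (abs_add_le _ _).trans (add_le_add ?_ ?_)
    · rw [Matrix.smul_apply, Matrix.one_apply, smul_eq_mul]
      split_ifs <;> simp [abs_of_pos hlam, hlam.le]
    · refine (Finset.abs_sum_le_sum_abs _ _).trans ?_
      refine (Finset.sum_le_card_nsmul _ _ 1 fun s hs => ?_).trans (by simp)
      have h1 := hx s (Finset.mem_Icc.1 hs).1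
      rw [Matrix.vecMulVec_apply, abs_mul]
      exact mul_le_one₀ ((PiLp.norm_apply_le (x s) i).trans h1) (abs_nonneg _)
        ((PiLp.norm_apply_le (x s) j).trans h1)
  have := Matrix.det_le (abv := AbsoluteValue.abs) hent
  simpa using (le_abs_self _).trans this

/-- A shift by `d` is a composition of `d` unit shifts, each of which telescopes to at most `G`;
hence the bound is independent of `n`. -/
lemma sum_sub_shift_le {g : ℕ → ℝ} {G : ℝ} (h0 : ∀ t, 0 ≤ g t) (hG : ∀ t, g t ≤ G) (n d : ℕ) :
    ∑ j ∈ Finset.range n, (g j - g (j + d)) ≤ d * G := by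
  induction d with
  | zero => simp
  | succ d ih =>
    have h1 : ∑ j ∈ Finset.range n, (g (j + d) - g (j + (d + 1))) = g d - g (n + d) := by
      have := Finset.sum_range_sub' (fun j => g (j + d)) n
      simpa [add_assoc, add_comm 1 d, add_left_comm] using this
    have h2 : ∑ j ∈ Finset.range n, (g j - g (j + (d + 1))) =
        ∑ j ∈ Finset.range n, (g j - g (j + d)) +
          ∑ j ∈ Finset.range n, (g (j + d) - g (j + (d + 1))) := by
      rw [← Finset.sum_add_distrib]
      exact Finset.sum_congr rfl fun j _ => by ring
    rw [h2, h1]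
    push_cast
    linarith [hG d, h0 (n + d)]

/-- The elliptic potential lemma under a delay of `d` rounds: the delay costs only an additive
term that does not depend on the horizon. -/
lemma sum_delayed_potential_le (hlam : 0 < lam) (hx : ∀ t, 1 ≤ t → ‖x t‖ ≤ 1) (d n : ℕ) :
    ∑ j ∈ Finset.range n, (x (j + 1 + d)).ofLp ⬝ᵥ
        ((designMatrix lam x (j + 1))⁻¹ *ᵥ (x (j + 1 + d)).ofLp) ≤
      Real.log (p.factorial * (lam + (n + d : ℕ)) ^ p) - p * Real.log lam + d * (p / lam) := by
  have hpd := fun t => designMatrix_posDef (x := x) hlam t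
  set g : ℕ → ℝ := fun j => (designMatrix lam x (j + 1))⁻¹.trace with hg
  set l : ℕ → ℝ := fun j => Real.log (designMatrix lam x j).det with hl
  have hl_mono : ∀ t, l t ≤ l (t + 1) := fun t => by
    have h := quadForm_inv_le_log_det (hpd t) (x (t + 1)).ofLp
    rw [← designMatrix_succ] at h
    linarith [quadForm_nonneg (hpd (t + 1)).inv.posSemidef (x (t + 1)).ofLp]
  have hball : ∀ t, 1 ≤ t → (x t).ofLp ⬝ᵥ (x t).ofLp ≤ 1 := fun t ht => by
    rw [dotProduct_eq_inner, real_inner_self_eq_norm_sq]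
    exact pow_le_one₀ (norm_nonneg _) (hx t ht)
  have hmono : ∀ s t, s ≤ t → ∀ u : Fin p → ℝ,
      u ⬝ᵥ (designMatrix lam x s *ᵥ u) ≤ u ⬝ᵥ (designMatrix lam x t *ᵥ u) := fun s t hst u =>
    matrixNormSq_designMatrix_mono hst (WithLp.toLp 2 u)
  have hterm : ∀ j, (x (j + 1 + d)).ofLp ⬝ᵥ
        ((designMatrix lam x (j + 1))⁻¹ *ᵥ (x (j + 1 + d)).ofLp) ≤
      (l (j + d + 1) - l (j + d)) + (g j - g (j + d)) := by
    intro j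
    have h1 := quadForm_inv_sub_le_trace (hpd (j + 1)) (hpd (j + d + 1)) (hmono _ _ (by omega))
      (hball (j + 1 + d) (by omega))
    have h2 := quadForm_inv_le_log_det (hpd (j + d)) (x (j + d + 1)).ofLp
    rw [← designMatrix_succ] at h2
    rw [show j + 1 + d = j + d + 1 by omega] at h1 ⊢
    linarith
  have hg0 : ∀ j, 0 ≤ g j := fun j => (hpd (j + 1)).inv.posSemidef.trace_nonneg
  have hgG : ∀ j, g j ≤ p / lam := by
    intro j
    have h1 : ∀ i, (designMatrix lam x (j + 1))⁻¹ i i ≤ lam⁻¹ := by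
      intro i
      have h := quadForm_inv_antitone (hpd 0) (hpd (j + 1)) (hmono _ _ (by omega)) (Pi.single i 1)
      rw [designMatrix_zero] at h
      have hinv : (lam • (1 : Matrix (Fin p) (Fin p) ℝ))⁻¹ = lam⁻¹ • 1 := by
        refine Matrix.inv_eq_right_inv ?_
        simp [smul_smul, hlam.ne']
      rw [hinv] at h
      simpa [Matrix.smul_mulVec] using h
    calc g j ≤ ∑ _i : Fin p, lam⁻¹ := Finset.sum_le_sum fun i _ => h1 i
      _ = p / lam := by simp [div_eq_mul_inv]
  refine (Finset.sum_le_sum fun j _ => hterm j).trans ?_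
  rw [Finset.sum_add_distrib]
  refine add_le_add ?_ (sum_sub_shift_le hg0 hgG n d)
  have h1 := Finset.sum_range_sub (fun j => l (j + d)) n
  have h2 : ∑ j ∈ Finset.range n, (l (j + d + 1) - l (j + d)) = l (n + d) - l d := by
    rw [zero_add] at h1
    rw [← h1]
    exact Finset.sum_congr rfl fun j _ => by rw [show j + d + 1 = j + 1 + d by omega]
  have h3 : l 0 ≤ l d := monotone_nat_of_le_succ hl_mono (Nat.zero_le d)
  have h4 : l 0 = p * Real.log lam := by
    simp [hl, designMatrix_zero]
  have h5 : l (n + d) ≤ Real.log (p.factorial * (lam + (n + d : ℕ)) ^ p) :=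
    Real.log_le_log (hpd _).det_pos (det_designMatrix_le hlam hx _)
  rw [h2]
  linarith

end EllipticPotential

/-! ### Ville's inequality and random exponents -/

section Ville

open scoped ENNReal

variable {Ω : Type*} {m mΩ : MeasurableSpace Ω} {μ : Measure Ω}

/-- Ville's maximal inequality for nonnegative supermartingales, over a finite horizon. -/
lemma ville_maximal_inequality {𝒢 : ℕ → MeasurableSpace Ω} (hle : ∀ n, 𝒢 n ≤ mΩ)
    (hmono : Monotone 𝒢) {M : ℕ → Ω → ℝ≥0∞} (hM : ∀ n, Measurable[𝒢 n] (M n))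
    (hstep : ∀ n A, MeasurableSet[𝒢 n] A → ∫⁻ ω in A, M (n + 1) ω ∂μ ≤ ∫⁻ ω in A, M n ω ∂μ)
    (c : ℝ≥0∞) (N : ℕ) :
    c * μ {ω | ∃ n ≤ N, c ≤ M n ω} ≤ ∫⁻ ω, M 0 ω ∂μ := by
  set H : ℕ → Set Ω := fun N => {ω | ∃ n ≤ N, c ≤ M n ω} with hH
  have hHmeas : ∀ N, MeasurableSet[𝒢 N] (H N) := by
    intro N
    have : H N = ⋃ n ∈ Set.Iic N, {ω | c ≤ M n ω} := by ext ω; simp [hH]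
    rw [this]
    refine MeasurableSet.biUnion (Set.to_countable _) fun n hn => ?_
    exact hmono hn _ (measurableSet_le measurable_const (hM n))
  have hHsucc : ∀ N, H (N + 1) = H N ∪ {ω | c ≤ M (N + 1) ω} := by
    intro N
    ext ω
    simp only [hH, Set.mem_ofPred_eq, Set.mem_union]
    constructor
    · rintro ⟨n, hn, h⟩
      rcases Nat.le_succ_iff.1 hn with h' | rfl
      · exact Or.inl ⟨n, h', h⟩
      · exact Or.inr h
    · rintro (⟨n, hn, h⟩ | h)
      · exact ⟨n, by omega, h⟩
      · exact ⟨N + 1, le_rfl, h⟩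
  have hcheb : ∀ n (S : Set Ω), MeasurableSet S →
      c * μ (S ∩ {ω | c ≤ M n ω}) + ∫⁻ ω in S \ {ω | c ≤ M n ω}, M n ω ∂μ ≤
        ∫⁻ ω in S, M n ω ∂μ := by
    intro n S hS
    have hmeas : MeasurableSet {ω | c ≤ M n ω} :=
      hle n _ (measurableSet_le measurable_const (hM n))
    rw [← lintegral_inter_add_sdiff (M n) S hmeas]
    gcongr
    rw [← setLIntegral_const]
    exact setLIntegral_mono' (hS.inter hmeas) fun ω hω => hω.2
  -- The induction must also carry the mass of `M N` where the level has not yet been reached; this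
  -- is the process stopped at its first crossing.
  have key : ∀ N, c * μ (H N) + ∫⁻ ω in (H N)ᶜ, M N ω ∂μ ≤ ∫⁻ ω, M 0 ω ∂μ := by
    intro N
    induction N with
    | zero =>
      have h := hcheb 0 Set.univ MeasurableSet.univ
      have h0 : H 0 = {ω | c ≤ M 0 ω} := by ext ω; simp [hH]
      rw [h0]
      simpa [Set.compl_eq_univ_sdiff] using h
    | succ N ih =>
      refine le_trans ?_ ih
      have h1 := hcheb (N + 1) (H N)ᶜ (hle N _ (hHmeas N)).compl
      have h2 := hstep N (H N)ᶜ (hHmeas N).compl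
      have h3 : (H (N + 1))ᶜ = (H N)ᶜ \ {ω | c ≤ M (N + 1) ω} := by
        rw [hHsucc, Set.compl_union, Set.sdiff_eq]
      have h4 : μ (H (N + 1)) ≤ μ (H N) + μ ((H N)ᶜ ∩ {ω | c ≤ M (N + 1) ω}) := by
        refine (measure_mono ?_).trans (measure_union_le _ _)
        rw [hHsucc]
        intro ω hω
        by_cases hN : ω ∈ H N
        · exact Or.inl hN
        · exact Or.inr ⟨hN, hω.resolve_left hN⟩
      calc c * μ (H (N + 1)) + ∫⁻ ω in (H (N + 1))ᶜ, M (N + 1) ω ∂μ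
          ≤ c * (μ (H N) + μ ((H N)ᶜ ∩ {ω | c ≤ M (N + 1) ω})) +
              ∫⁻ ω in (H N)ᶜ \ {ω | c ≤ M (N + 1) ω}, M (N + 1) ω ∂μ := by
            rw [h3]; gcongr
        _ = c * μ (H N) + (c * μ ((H N)ᶜ ∩ {ω | c ≤ M (N + 1) ω}) +
              ∫⁻ ω in (H N)ᶜ \ {ω | c ≤ M (N + 1) ω}, M (N + 1) ω ∂μ) := by
            rw [mul_add, add_assoc]
        _ ≤ c * μ (H N) + ∫⁻ ω in (H N)ᶜ, M N ω ∂μ := by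
            gcongr
            exact h1.trans h2
  exact le_self_add.trans (key N)

/-- By `hsub`, tilting `μ` by the exponential does not increase the measure of any event of `m`,
hence does not increase integrals of `m`-measurable functions. Stating this through sets and lower
integrals avoids integrability conditions on `Z`. -/
lemma lintegral_mul_exp_const_le (hm : m ≤ mΩ) {ξ : Ω → ℝ}
    (hξ : Measurable ξ)
    (hsub : ∀ (l : ℝ) (A : Set Ω), MeasurableSet[m] A →
      ∫⁻ ω in A, ENNReal.ofReal (Real.exp (ξ ω * l - l ^ 2 / 2)) ∂μ ≤ μ A)
    {Z : Ω → ℝ≥0∞} (hZ : Measurable[m] Z) (l : ℝ) :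
    ∫⁻ ω, Z ω * ENNReal.ofReal (Real.exp (ξ ω * l - l ^ 2 / 2)) ∂μ ≤ ∫⁻ ω, Z ω ∂μ := by
  set g : Ω → ℝ≥0∞ := fun ω => ENNReal.ofReal (Real.exp (ξ ω * l - l ^ 2 / 2)) with hg
  have hgm : Measurable g := by fun_prop
  have hle : (μ.withDensity g).trim hm ≤ μ.trim hm := by
    refine Measure.le_iff.2 fun A hA => ?_
    rw [trim_measurableSet_eq hm hA, trim_measurableSet_eq hm hA, withDensity_apply _ (hm A hA)]
    exact hsub l A hA
  calc ∫⁻ ω, Z ω * g ω ∂μ = ∫⁻ ω, Z ω ∂(μ.withDensity g) := by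
        rw [lintegral_withDensity_eq_lintegral_mul _ hgm (hZ.mono hm le_rfl)]
        simp [mul_comm]
    _ = ∫⁻ ω, Z ω ∂((μ.withDensity g).trim hm) := (lintegral_trim hm hZ).symm
    _ ≤ ∫⁻ ω, Z ω ∂(μ.trim hm) := lintegral_mono' hle le_rfl
    _ = ∫⁻ ω, Z ω ∂μ := lintegral_trim hm hZ

lemma exists_tendsto_finite_range {a : Ω → ℝ} (ha : Measurable[m] a) :
    ∃ b : ℕ → Ω → ℝ, (∀ n, Measurable[m] (b n)) ∧ (∀ n, ∃ R : Finset ℝ, ∀ ω, b n ω ∈ R) ∧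
      ∀ ω, Tendsto (fun n => b n ω) atTop (nhds (a ω)) :=
  ⟨fun n => ha.stronglyMeasurable.approx n, fun n => (ha.stronglyMeasurable.approx n).measurable,
    fun n => ⟨(ha.stronglyMeasurable.approx n).range, SimpleFunc.mem_range_self _⟩,
    ha.stronglyMeasurable.tendsto_approx⟩

/-- A conditional sub-Gaussian bound at all deterministic exponents extends to random exponents
that are measurable with respect to the conditioning `σ`-field. -/
lemma lintegral_mul_exp_le (hm : m ≤ mΩ) {ξ : Ω → ℝ}
    (hξ : Measurable ξ)
    (hsub : ∀ (l : ℝ) (A : Set Ω), MeasurableSet[m] A →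
      ∫⁻ ω in A, ENNReal.ofReal (Real.exp (ξ ω * l - l ^ 2 / 2)) ∂μ ≤ μ A)
    {Z : Ω → ℝ≥0∞} (hZ : Measurable[m] Z) {a : Ω → ℝ} (ha : Measurable[m] a) :
    ∫⁻ ω, Z ω * ENNReal.ofReal (Real.exp (ξ ω * a ω - a ω ^ 2 / 2)) ∂μ ≤ ∫⁻ ω, Z ω ∂μ := by
  have hZ' : Measurable Z := hZ.mono hm le_rfl
  -- A finite-range exponent is constant on finitely many level sets lying in `m`, where the
  -- deterministic case applies; Fatou's lemma then passes to the limit.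
  obtain ⟨b, hbm, hbR, hlim⟩ := exists_tendsto_finite_range ha
  have hbm' : ∀ n, Measurable (b n) := fun n => (hbm n).mono hm le_rfl
  have hsimple : ∀ n, ∫⁻ ω, Z ω * ENNReal.ofReal (Real.exp (ξ ω * b n ω - b n ω ^ 2 / 2)) ∂μ ≤
      ∫⁻ ω, Z ω ∂μ := by
    intro n
    obtain ⟨R, hmem⟩ := hbR n
    have hset : ∀ l, MeasurableSet[m] {ω | b n ω = l} := fun l =>
      (hbm n) (measurableSet_singleton l)
    have hdec : ∀ (F : ℝ → Ω → ℝ≥0∞) (ω : Ω), F (b n ω) ω =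
        ∑ l ∈ R, {ω | b n ω = l}.indicator (F l) ω := by
      intro F ω
      rw [Finset.sum_eq_single_of_mem (b n ω) (hmem ω)]
      · simp
      · intro l _ hl
        exact Set.indicator_of_notMem (fun h => hl h.symm) _
    have hZl : ∀ l, Measurable[m] ({ω | b n ω = l}.indicator Z) := fun l =>
      hZ.indicator (hset l)
    calc ∫⁻ ω, Z ω * ENNReal.ofReal (Real.exp (ξ ω * b n ω - b n ω ^ 2 / 2)) ∂μ
        = ∫⁻ ω, ∑ l ∈ R, {ω | b n ω = l}.indicator Z ω *
            ENNReal.ofReal (Real.exp (ξ ω * l - l ^ 2 / 2)) ∂μ := by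
          refine lintegral_congr fun ω => ?_
          rw [hdec (fun l ω => Z ω * ENNReal.ofReal (Real.exp (ξ ω * l - l ^ 2 / 2))) ω]
          refine Finset.sum_congr rfl fun l _ => ?_
          by_cases h : ω ∈ {ω | b n ω = l}
          · rw [Set.indicator_of_mem h, Set.indicator_of_mem h]
          · rw [Set.indicator_of_notMem h, Set.indicator_of_notMem h, zero_mul]
      _ = ∑ l ∈ R, ∫⁻ ω, {ω | b n ω = l}.indicator Z ω *
            ENNReal.ofReal (Real.exp (ξ ω * l - l ^ 2 / 2)) ∂μ := by
          refine lintegral_finsetSum _ fun l _ => ?_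
          exact ((hZl l).mono hm le_rfl).mul (by fun_prop)
      _ ≤ ∑ l ∈ R, ∫⁻ ω, {ω | b n ω = l}.indicator Z ω ∂μ :=
          Finset.sum_le_sum fun l _ => lintegral_mul_exp_const_le hm hξ hsub (hZl l) l
      _ = ∫⁻ ω, Z ω ∂μ := by
          rw [← lintegral_finsetSum _ fun l _ => (hZl l).mono hm le_rfl]
          exact lintegral_congr fun ω => (hdec (fun _ => Z) ω).symm
  have hpt : ∀ ω, Tendsto (fun n => Z ω * ENNReal.ofReal (Real.exp (ξ ω * b n ω - b n ω ^ 2 / 2)))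
      atTop (nhds (Z ω * ENNReal.ofReal (Real.exp (ξ ω * a ω - a ω ^ 2 / 2)))) := by
    intro ω
    refine ENNReal.Tendsto.const_mul ?_ (Or.inl ?_)
    · have hc : Continuous fun y : ℝ => ENNReal.ofReal (Real.exp (ξ ω * y - y ^ 2 / 2)) :=
        ENNReal.continuous_ofReal.comp (by fun_prop)
      exact (hc.tendsto _).comp (hlim ω)
    · exact (ENNReal.ofReal_pos.2 (Real.exp_pos _)).ne'
  calc ∫⁻ ω, Z ω * ENNReal.ofReal (Real.exp (ξ ω * a ω - a ω ^ 2 / 2)) ∂μ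
      = ∫⁻ ω, liminf (fun n => Z ω *
          ENNReal.ofReal (Real.exp (ξ ω * b n ω - b n ω ^ 2 / 2))) atTop ∂μ :=
        lintegral_congr fun ω => (hpt ω).liminf_eq.symm
    _ ≤ liminf (fun n => ∫⁻ ω, Z ω *
          ENNReal.ofReal (Real.exp (ξ ω * b n ω - b n ω ^ 2 / 2)) ∂μ) atTop := by
        refine lintegral_liminf_le fun n => hZ'.mul ?_
        have := hbm' n
        fun_prop
    _ ≤ ∫⁻ ω, Z ω ∂μ := by
        refine (liminf_le_liminf (Eventually.of_forall hsimple)).trans ?_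
        simp

end Ville

/-! ### The method of mixtures with a Gaussian prior -/

section Mixture

open scoped ENNReal

variable {p : ℕ}

/-- The log-likelihood-ratio process of the method of mixtures. -/
noncomputable def mixtureExponent (ξ : ℕ → ℝ) (x : ℕ → EuclideanSpace ℝ (Fin p))
    (θ₀ θ : EuclideanSpace ℝ (Fin p)) (n : ℕ) : ℝ :=
  ∑ k ∈ Finset.range n, (ξ k * inner ℝ (θ - θ₀) (x k) - inner ℝ (θ - θ₀) (x k) ^ 2 / 2)

/-- The unnormalised centred Gaussian measure with precision `ρ`. -/
noncomputable def gaussianPrior (p : ℕ) (ρ : ℝ) : Measure (EuclideanSpace ℝ (Fin p)) :=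
  volume.withDensity fun θ => ENNReal.ofReal (Real.exp (-(ρ / 2) * ‖θ‖ ^ 2))

lemma lintegral_exp_neg_mul_sq_norm {b : ℝ} (hb : 0 < b) :
    ∫⁻ θ : EuclideanSpace ℝ (Fin p), ENNReal.ofReal (Real.exp (-b * ‖θ‖ ^ 2)) =
      ENNReal.ofReal ((Real.pi / b) ^ ((p : ℝ) / 2)) := by
  have h := GaussianFourier.integral_rexp_neg_mul_sq_norm (V := EuclideanSpace ℝ (Fin p)) hb
  have hpos : 0 < (Real.pi / b) ^ ((p : ℝ) / 2) := by positivity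
  rw [finrank_euclideanSpace_fin] at h
  rw [← h, ofReal_integral_eq_lintegral_ofReal _ (Eventually.of_forall fun θ => (Real.exp_pos _).le)]
  -- A non-integrable function has Bochner integral `0`, contradicting the positive value in `h`.
  by_contra hni
  rw [integral_undef hni] at h
  exact hpos.ne h

lemma gaussianPrior_univ {ρ : ℝ} (hρ : 0 < ρ) :
    gaussianPrior p ρ Set.univ = ENNReal.ofReal ((Real.pi / (ρ / 2)) ^ ((p : ℝ) / 2)) := by
  rw [gaussianPrior, withDensity_apply _ MeasurableSet.univ, Measure.restrict_univ,
    lintegral_exp_neg_mul_sq_norm (half_pos hρ)]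

/-- Laplace lower bound for a Gaussian mixture of a concave quadratic exponential. -/
lemma le_lintegral_gaussianPrior {ρ : ℝ} (hρ : 0 < ρ) (ξ : ℕ → ℝ)
    {x : ℕ → EuclideanSpace ℝ (Fin p)} (hx : ∀ k, ‖x k‖ ≤ 1)
    (θ₀ θ : EuclideanSpace ℝ (Fin p)) (n : ℕ) :
    ENNReal.ofReal (Real.exp (mixtureExponent ξ x θ₀ θ n - ρ / 2 * ‖θ‖ ^ 2) *
        (Real.pi / ((n + ρ) / 2)) ^ ((p : ℝ) / 2)) ≤
      ∫⁻ u, ENNReal.ofReal (Real.exp (mixtureExponent ξ x θ₀ u n)) ∂(gaussianPrior p ρ) := by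
  set q : EuclideanSpace ℝ (Fin p) → ℝ := fun u =>
    mixtureExponent ξ x θ₀ u n - ρ / 2 * ‖u‖ ^ 2 with hq
  have hqc : Continuous q := by
    simp only [hq, mixtureExponent]
    fun_prop
  have hint : ∫⁻ u, ENNReal.ofReal (Real.exp (mixtureExponent ξ x θ₀ u n)) ∂(gaussianPrior p ρ) =
      ∫⁻ u, ENNReal.ofReal (Real.exp (q u)) := by
    rw [gaussianPrior, lintegral_withDensity_eq_lintegral_mul _ (by fun_prop)]
    · refine lintegral_congr fun u => ?_
      rw [Pi.mul_apply, ← ENNReal.ofReal_mul (Real.exp_pos _).le, ← Real.exp_add]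
      congr 2
      simp only [hq]
      ring
    · simp only [mixtureExponent]
      fun_prop
  -- Pairing `h` with `-h` cancels the linear term of the quadratic `q`, so `θ` need not be its
  -- maximiser. The curvature is at most `n + ρ` because the `x k` lie in the unit ball.
  have hmid : ∀ h, 2 * q θ - (n + ρ) * ‖h‖ ^ 2 ≤ q (θ + h) + q (θ + -h) := by
    intro h
    have h1 : mixtureExponent ξ x θ₀ (θ + h) n + mixtureExponent ξ x θ₀ (θ + -h) n =
        2 * mixtureExponent ξ x θ₀ θ n - ∑ k ∈ Finset.range n, inner ℝ h (x k) ^ 2 := by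
      simp only [mixtureExponent]
      rw [Finset.mul_sum, ← Finset.sum_add_distrib, ← Finset.sum_sub_distrib]
      refine Finset.sum_congr rfl fun k _ => ?_
      simp only [inner_sub_left, inner_add_left, inner_neg_left]
      ring
    have h2 : ∑ k ∈ Finset.range n, inner ℝ h (x k) ^ 2 ≤ n * ‖h‖ ^ 2 := by
      refine (Finset.sum_le_card_nsmul _ _ (‖h‖ ^ 2) fun k _ => ?_).trans (by simp)
      refine sq_le_sq' ?_ ?_
      · have := neg_le_of_abs_le (abs_real_inner_le_norm h (x k))
        nlinarith [norm_nonneg h, hx k]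
      · have := le_of_abs_le (abs_real_inner_le_norm h (x k))
        nlinarith [norm_nonneg h, hx k]
    have h3 : ‖θ + h‖ ^ 2 + ‖θ + -h‖ ^ 2 = 2 * ‖θ‖ ^ 2 + 2 * ‖h‖ ^ 2 := by
      have := parallelogram_law_with_norm ℝ θ h
      rw [← sub_eq_add_neg]
      nlinarith
    simp only [hq]
    nlinarith
  -- The arithmetic-geometric mean inequality applied to `hmid`.
  have hexp : ∀ h, 2 * (Real.exp (q θ) * Real.exp (-((n + ρ) / 2) * ‖h‖ ^ 2)) ≤
      Real.exp (q (θ + h)) + Real.exp (q (θ + -h)) := by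
    intro h
    have h1 : Real.exp (q θ) * Real.exp (-((n + ρ) / 2) * ‖h‖ ^ 2) ≤
        Real.exp (q (θ + h) / 2) * Real.exp (q (θ + -h) / 2) := by
      rw [← Real.exp_add, ← Real.exp_add]
      exact Real.exp_le_exp.2 (by linarith [hmid h])
    have h2 : ∀ y, Real.exp y = Real.exp (y / 2) ^ 2 := fun y => by
      rw [← Real.exp_nat_mul]; congr 1; push_cast; ring
    rw [h2 (q (θ + h)), h2 (q (θ + -h))]
    nlinarith [sq_nonneg (Real.exp (q (θ + h) / 2) - Real.exp (q (θ + -h) / 2))]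
  have hm1 : Measurable fun h => ENNReal.ofReal (Real.exp (q (θ + h))) := by fun_prop
  have hI1 : ∫⁻ h, ENNReal.ofReal (Real.exp (q (θ + h))) = ∫⁻ u, ENNReal.ofReal (Real.exp (q u)) :=
    lintegral_add_left_eq_self (fun u => ENNReal.ofReal (Real.exp (q u))) θ
  have hI2 : ∫⁻ h, ENNReal.ofReal (Real.exp (q (θ + -h))) =
      ∫⁻ u, ENNReal.ofReal (Real.exp (q u)) := by
    rw [← hI1]
    exact (Measure.measurePreserving_neg volume).lintegral_comp hm1
  have hG : ∫⁻ h : EuclideanSpace ℝ (Fin p), ENNReal.ofReal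
        (Real.exp (q θ) * Real.exp (-((n + ρ) / 2) * ‖h‖ ^ 2)) =
      ENNReal.ofReal (Real.exp (q θ) * (Real.pi / ((n + ρ) / 2)) ^ ((p : ℝ) / 2)) := by
    simp_rw [ENNReal.ofReal_mul (Real.exp_pos (q θ)).le]
    rw [lintegral_const_mul _ (by fun_prop), lintegral_exp_neg_mul_sq_norm (by positivity)]
  rw [hint, ← hG]
  have htwo : 2 * ∫⁻ h : EuclideanSpace ℝ (Fin p), ENNReal.ofReal
        (Real.exp (q θ) * Real.exp (-((n + ρ) / 2) * ‖h‖ ^ 2)) ≤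
      2 * ∫⁻ u, ENNReal.ofReal (Real.exp (q u)) := by
    rw [two_mul (∫⁻ u, ENNReal.ofReal (Real.exp (q u)))]
    nth_rewrite 1 [← hI1]
    rw [← hI2, ← lintegral_add_left hm1, ← lintegral_const_mul _ (by fun_prop)]
    refine lintegral_mono fun h => ?_
    have h2 : ∀ y, 2 * ENNReal.ofReal y = ENNReal.ofReal (2 * y) := fun y => by
      rw [ENNReal.ofReal_mul zero_le_two, ENNReal.ofReal_ofNat]
    rw [← ENNReal.ofReal_add (Real.exp_pos _).le (Real.exp_pos _).le, h2]
    exact ENNReal.ofReal_le_ofReal (hexp h)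
  exact (ENNReal.mul_le_mul_iff_right (by norm_num) (by norm_num)).1 htwo

lemma measurable_mixtureExponent {Ω : Type*} {m : MeasurableSpace Ω} {ξ : ℕ → Ω → ℝ}
    {x : ℕ → Ω → EuclideanSpace ℝ (Fin p)} {n : ℕ} (hξ : ∀ k < n, Measurable (ξ k))
    (hx : ∀ k < n, Measurable (x k)) (θ₀ : EuclideanSpace ℝ (Fin p)) :
    Measurable fun z : EuclideanSpace ℝ (Fin p) × Ω =>
      mixtureExponent (fun k => ξ k z.2) (fun k => x k z.2) θ₀ z.1 n := by
  refine Finset.measurable_sum _ fun k hk => ?_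
  have hsnd : Measurable (Prod.snd : EuclideanSpace ℝ (Fin p) × Ω → Ω) := measurable_snd
  have h1 := (hξ k (Finset.mem_range.1 hk)).comp hsnd
  have h2 := (hx k (Finset.mem_range.1 hk)).comp hsnd
  have h3 : Measurable fun z : EuclideanSpace ℝ (Fin p) × Ω =>
      inner ℝ (z.1 - θ₀) (x k z.2) := (measurable_fst.sub_const θ₀).inner h2
  exact (h1.mul h3).sub ((h3.pow_const 2).div_const 2)

instance (ρ : ℝ) : SFinite (gaussianPrior p ρ) := by
  unfold gaussianPrior; infer_instance

lemma measurable_lintegral_mixture {Ω : Type*} {m : MeasurableSpace Ω} {ξ : ℕ → Ω → ℝ}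
    {x : ℕ → Ω → EuclideanSpace ℝ (Fin p)} {n : ℕ} (hξ : ∀ k < n, Measurable (ξ k))
    (hx : ∀ k < n, Measurable (x k)) (θ₀ : EuclideanSpace ℝ (Fin p)) (ρ : ℝ) :
    Measurable fun ω => ∫⁻ θ, ENNReal.ofReal (Real.exp
      (mixtureExponent (fun k => ξ k ω) (fun k => x k ω) θ₀ θ n)) ∂(gaussianPrior p ρ) :=
  Measurable.lintegral_prod_left' (measurable_mixtureExponent hξ hx θ₀).exp.ennreal_ofReal

/-- Time-uniform deviation inequality for vector-valued self-normalised processes with conditionally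
sub-Gaussian increments, by the method of mixtures. -/
lemma measure_exists_lt_mixtureExponent_le {Ω : Type*} {mΩ : MeasurableSpace Ω} {μ : Measure Ω}
    [IsProbabilityMeasure μ] {𝒢 : ℕ → MeasurableSpace Ω} (hle : ∀ n, 𝒢 n ≤ mΩ)
    (hmono : Monotone 𝒢) {ξ : ℕ → Ω → ℝ} (hξ : ∀ k, Measurable[𝒢 (k + 1)] (ξ k))
    {x : ℕ → Ω → EuclideanSpace ℝ (Fin p)} (hx : ∀ k, Measurable[𝒢 k] (x k))
    (hx1 : ∀ k ω, ‖x k ω‖ ≤ 1)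
    (hsub : ∀ (k : ℕ) (l : ℝ) (A : Set Ω), MeasurableSet[𝒢 k] A →
      ∫⁻ ω in A, ENNReal.ofReal (Real.exp (ξ k ω * l - l ^ 2 / 2)) ∂μ ≤ μ A)
    (θ₀ : EuclideanSpace ℝ (Fin p)) {ρ B η : ℝ} (hρ : 0 < ρ) (hη : 0 < η) (N : ℕ) :
    μ {ω | ∃ n ≤ N, ∃ θ ∈ Metric.closedBall (0 : EuclideanSpace ℝ (Fin p)) B,
      ρ / 2 * B ^ 2 + p / 2 * Real.log ((n + ρ) / ρ) + Real.log (1 / η) <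
        mixtureExponent (fun k => ξ k ω) (fun k => x k ω) θ₀ θ n} ≤ ENNReal.ofReal η := by
  set L : ℕ → EuclideanSpace ℝ (Fin p) → Ω → ℝ := fun n θ ω =>
    mixtureExponent (fun k => ξ k ω) (fun k => x k ω) θ₀ θ n with hL
  set M : ℕ → Ω → ℝ≥0∞ := fun n ω =>
    ∫⁻ θ, ENNReal.ofReal (Real.exp (L n θ ω)) ∂(gaussianPrior p ρ) with hM
  have hξ' : ∀ n, ∀ k < n, Measurable[𝒢 n] (ξ k) := fun n k hk =>
    (hξ k).mono (hmono hk) le_rfl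
  have hx' : ∀ n, ∀ k < n, Measurable[𝒢 n] (x k) := fun n k hk =>
    (hx k).mono (hmono hk.le) le_rfl
  have hξΩ : ∀ k, Measurable (ξ k) := fun k => (hξ k).mono (hle _) le_rfl
  have hxΩ : ∀ k, Measurable (x k) := fun k => (hx k).mono (hle _) le_rfl
  have hMm : ∀ n, Measurable[𝒢 n] (M n) := fun n =>
    measurable_lintegral_mixture (hξ' n) (hx' n) θ₀ ρ
  have hLm : ∀ n, Measurable fun z : EuclideanSpace ℝ (Fin p) × Ω => L n z.1 z.2 := fun n =>
    measurable_mixtureExponent (fun k _ => hξΩ k) (fun k _ => hxΩ k) θ₀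
  have hswap : ∀ n A, ∫⁻ ω in A, M n ω ∂μ =
      ∫⁻ θ, ∫⁻ ω in A, ENNReal.ofReal (Real.exp (L n θ ω)) ∂μ ∂(gaussianPrior p ρ) := fun n A =>
    (lintegral_lintegral_swap (hLm n).exp.ennreal_ofReal.aemeasurable).symm
  have hstep : ∀ n A, MeasurableSet[𝒢 n] A →
      ∫⁻ ω in A, M (n + 1) ω ∂μ ≤ ∫⁻ ω in A, M n ω ∂μ := by
    intro n A hA
    -- Tonelli reduces the supermartingale property of the mixture to that of each fixed `θ`.
    rw [hswap, hswap]
    refine lintegral_mono fun θ => ?_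
    rw [← lintegral_indicator (hle n A hA), ← lintegral_indicator (hle n A hA)]
    have hLn : Measurable[𝒢 n] (L n θ) :=
      (measurable_mixtureExponent (hξ' n) (hx' n) θ₀).comp
        (@measurable_prodMk_left _ _ _ (𝒢 n) θ)
    have hZ : Measurable[𝒢 n] (A.indicator fun ω => ENNReal.ofReal (Real.exp (L n θ ω))) :=
      (hLn.exp.ennreal_ofReal).indicator hA
    have ha : Measurable[𝒢 n] fun ω => inner ℝ (θ - θ₀) (x n ω) :=
      Measurable.inner measurable_const (hx n)
    refine le_trans (le_of_eq (lintegral_congr fun ω => ?_))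
      (lintegral_mul_exp_le (hle n) (hξΩ n) (hsub n) hZ ha)
    by_cases hω : ω ∈ A
    · rw [Set.indicator_of_mem hω, Set.indicator_of_mem hω,
        ← ENNReal.ofReal_mul (Real.exp_pos _).le, ← Real.exp_add]
      simp only [hL, mixtureExponent, Finset.sum_range_succ]
    · rw [Set.indicator_of_notMem hω, Set.indicator_of_notMem hω, zero_mul]
  set c₀ : ℝ := (Real.pi / (ρ / 2)) ^ ((p : ℝ) / 2) with hc₀
  have hc₀pos : 0 < c₀ := by positivity
  have hM0 : ∫⁻ ω, M 0 ω ∂μ = ENNReal.ofReal c₀ := by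
    simp [hM, hL, mixtureExponent, gaussianPrior_univ hρ, hc₀]
  have hV := ville_maximal_inequality hle hmono hMm hstep (ENNReal.ofReal (c₀ / η)) N
  rw [hM0] at hV
  have hsubset : {ω | ∃ n ≤ N, ∃ θ ∈ Metric.closedBall (0 : EuclideanSpace ℝ (Fin p)) B,
      ρ / 2 * B ^ 2 + p / 2 * Real.log ((n + ρ) / ρ) + Real.log (1 / η) < L n θ ω} ⊆
      {ω | ∃ n ≤ N, ENNReal.ofReal (c₀ / η) ≤ M n ω} := by
    rintro ω ⟨n, hn, θ, hθ, h⟩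
    refine ⟨n, hn, le_trans (ENNReal.ofReal_le_ofReal ?_)
      (le_lintegral_gaussianPrior hρ (fun k => ξ k ω) (fun k => hx1 k ω) θ₀ θ n)⟩
    have hnρ : (0 : ℝ) < n + ρ := by positivity
    have hθB : ‖θ‖ ^ 2 ≤ B ^ 2 := by
      have : ‖θ‖ ≤ B := by simpa using hθ
      gcongr
    -- The ratio of the prior mass to the Laplace mass is `((n + ρ) / ρ) ^ (p / 2)`, the source of
    -- the logarithmic term.
    have hratio : c₀ = (Real.pi / ((n + ρ) / 2)) ^ ((p : ℝ) / 2) *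
        Real.exp (p / 2 * Real.log ((n + ρ) / ρ)) := by
      rw [mul_comm ((p : ℝ) / 2), ← Real.rpow_def_of_pos (by positivity),
        ← Real.mul_rpow (by positivity) (by positivity), hc₀]
      congr 1
      field_simp
    have hηexp : 1 / η = Real.exp (Real.log (1 / η)) := (Real.exp_log (by positivity)).symm
    rw [div_eq_mul_one_div, hηexp, hratio, mul_assoc, ← Real.exp_add, mul_comm]
    gcongr
    have h' : ρ / 2 * B ^ 2 + p / 2 * Real.log ((n + ρ) / ρ) + Real.log (1 / η) <
      mixtureExponent (fun k => ξ k ω) (fun k => x k ω) θ₀ θ n := h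
    nlinarith
  calc _ ≤ μ {ω | ∃ n ≤ N, ENNReal.ofReal (c₀ / η) ≤ M n ω} := measure_mono hsubset
    _ ≤ ENNReal.ofReal η := by
      have hpos : 0 < c₀ / η := by positivity
      refine (ENNReal.mul_le_mul_iff_right (ENNReal.ofReal_pos.2 hpos).ne'
        ENNReal.ofReal_ne_top).1 (hV.trans (le_of_eq ?_))
      rw [← ENNReal.ofReal_mul hpos.le, div_mul_cancel₀ _ hη.ne']

end Mixture

/-! ### Mixing noise along residue classes -/

section Noise

variable {Ω : Type*} {mΩ : MeasurableSpace Ω} {μ : Measure Ω} {φ : ℕ → ℝ} {ε : ℕ → Ω → ℝ}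

lemma noiseSigma_mono (ε : ℕ → Ω → ℝ) : Monotone (noiseSigma ε) := fun _ _ h =>
  biSup_mono fun _ hr => ⟨hr.1, hr.2.trans h⟩

lemma noiseSigma_le (hε : ∀ t, 1 ≤ t → Measurable (ε t)) (t : ℕ) : noiseSigma ε t ≤ mΩ :=
  iSup₂_le fun s hs => (hε s hs.1).comap_le

lemma measurable_noiseSigma {t : ℕ} (ht : 1 ≤ t) : Measurable[noiseSigma ε t] (ε t) :=
  (comap_measurable (ε t)).mono
    (le_iSup₂ (f := fun s (_ : s ∈ Set.Icc 1 t) => MeasurableSpace.comap (ε s) inferInstance) t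
      ⟨ht, le_rfl⟩) le_rfl

lemma noiseSigma_zero (ε : ℕ → Ω → ℝ) : noiseSigma ε 0 = ⊥ := by
  simp [noiseSigma]

/-- The conditional mean of the noise given the information available `d` rounds earlier. -/
noncomputable def noiseMean (μ : Measure Ω) (ε : ℕ → Ω → ℝ) (d t : ℕ) : Ω → ℝ :=
  μ[ε t | noiseSigma ε (t - d)]

lemma measurable_noiseMean (d t : ℕ) : Measurable[noiseSigma ε (t - d)] (noiseMean μ ε d t) :=
  stronglyMeasurable_condExp.measurable

variable [IsProbabilityMeasure μ]

/-- The mixing conditions are assumed only for `t > d`. In earlier rounds `t - d = 0`, the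
conditioning is trivial, and centring takes their place. -/
lemma noiseMean_eq_zero (h : IsMixingSubGaussian μ 1 φ ε) {d t : ℕ} (ht : 1 ≤ t) (htd : t ≤ d) :
    noiseMean μ ε d t = 0 := by
  rw [noiseMean, Nat.sub_eq_zero_of_le htd, noiseSigma_zero, condExp_bot, (h.centred t ht).2]
  rfl

lemma abs_noiseMean_le (h : IsMixingSubGaussian μ 1 φ ε) {d t : ℕ} (hd : 1 ≤ d) (ht : 1 ≤ t) :
    ∀ᵐ ω ∂μ, |noiseMean μ ε d t ω| ≤ φ d := by
  rcases lt_or_ge d t with hdt | htd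
  · exact h.cond_mean d t hd hdt
  · refine Eventually.of_forall fun ω => ?_
    rw [noiseMean_eq_zero h ht htd]
    simpa using h.coeff_nonneg d

/-- The conditional mean is bounded, so integrability follows from the unconditional sub-Gaussian
bound. It is needed because `condExp` of a non-integrable function is `0` and would make the
conditional hypothesis empty. -/
lemma integrable_exp_noise (h : IsMixingSubGaussian μ 1 φ ε) {d t : ℕ} (hd : 1 ≤ d) (ht : 1 ≤ t)
    (l : ℝ) : Integrable (fun ω => Real.exp (l * (ε t ω - noiseMean μ ε d t ω))) μ := by
  have h1 := (h.subGaussian t ht).integrable_exp_mul l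
  have hm : Measurable (noiseMean μ ε d t) :=
    (measurable_noiseMean d t).mono (noiseSigma_le h.measurable _) le_rfl
  have h2 := h1.mul_bdd (c := Real.exp (|l| * φ d))
    (g := fun ω => Real.exp (-(l * noiseMean μ ε d t ω))) (by fun_prop) ?_
  · refine h2.congr (Eventually.of_forall fun ω => ?_)
    simp only
    rw [← Real.exp_add]
    ring_nf
  · filter_upwards [abs_noiseMean_le h hd ht] with ω hω
    rw [Real.norm_eq_abs, abs_of_pos (Real.exp_pos _)]
    refine Real.exp_le_exp.2 ((neg_le_abs _).trans ?_)
    rw [abs_mul]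
    gcongr

lemma setLIntegral_exp_noise_le (h : IsMixingSubGaussian μ 1 φ ε) {d t : ℕ} (hd : 1 ≤ d)
    (ht : 1 ≤ t) (l : ℝ) {A : Set Ω} (hA : MeasurableSet[noiseSigma ε (t - d)] A) :
    ∫⁻ ω in A, ENNReal.ofReal
      (Real.exp ((ε t ω - noiseMean μ ε d t ω) * l - l ^ 2 / 2)) ∂μ ≤ μ A := by
  have hle := noiseSigma_le h.measurable (t - d)
  have hint := integrable_exp_noise h hd ht l
  have hreal : ∫ ω in A, Real.exp (l * (ε t ω - noiseMean μ ε d t ω)) ∂μ ≤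
      Real.exp (l ^ 2 / 2) * μ.real A := by
    rcases lt_or_ge d t with hdt | htd
    · rw [← setIntegral_condExp hle hint hA, mul_comm, ← smul_eq_mul, ← setIntegral_const]
      refine setIntegral_mono_ae integrable_condExp.integrableOn
        (integrable_const _).integrableOn ?_
      filter_upwards [h.cond_subGaussian d t hd hdt l] with ω hω
      simp only [NNReal.coe_one, one_pow, mul_one] at hω
      exact hω
    · rw [Nat.sub_eq_zero_of_le htd, noiseSigma_zero] at hA
      rcases MeasurableSpace.measurableSet_bot_iff.1 hA with rfl | rfl
      · simp
      · have := (h.subGaussian t ht).mgf_le l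
        simpa [noiseMean_eq_zero h ht htd, mgf] using this
  have hsplit : ∀ ω, Real.exp ((ε t ω - noiseMean μ ε d t ω) * l - l ^ 2 / 2) =
      Real.exp (-(l ^ 2 / 2)) * Real.exp (l * (ε t ω - noiseMean μ ε d t ω)) := fun ω => by
    rw [← Real.exp_add]; ring_nf
  simp_rw [hsplit]
  rw [← ofReal_integral_eq_lintegral_ofReal (hint.integrableOn.const_mul _)
    (Eventually.of_forall fun ω => by positivity), integral_const_mul, ← ofReal_measureReal]
  refine ENNReal.ofReal_le_ofReal ?_
  calc _ ≤ Real.exp (-(l ^ 2 / 2)) * (Real.exp (l ^ 2 / 2) * μ.real A) := by gcongr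
    _ = μ.real A := by rw [← mul_assoc, ← Real.exp_add]; simp

variable {p : ℕ}

/-- The deviation inequality holds simultaneously in all residue classes modulo the delay. -/
lemma exists_measure_le_forall_mixtureExponent_le (h : IsMixingSubGaussian μ 1 φ ε)
    {X : ℕ → Ω → EuclideanSpace ℝ (Fin p)} {d : ℕ} (hd : 1 ≤ d)
    (hX : ∀ t, 1 ≤ t → Measurable[noiseSigma ε (t - d)] (X t))
    (hX1 : ∀ t, 1 ≤ t → ∀ ω, ‖X t ω‖ ≤ 1) (θ₀ : EuclideanSpace ℝ (Fin p)) {ρ B δ : ℝ}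
    (hρ : 0 < ρ) (hδ : 0 < δ) (N : ℕ) :
    ∃ S : Set Ω, μ S ≤ ENNReal.ofReal δ ∧ ∀ ω ∉ S,
      (∀ s, 1 ≤ s → |noiseMean μ ε d s ω| ≤ φ d) ∧
      ∀ i < d, ∀ n ≤ N, ∀ θ ∈ Metric.closedBall (0 : EuclideanSpace ℝ (Fin p)) B,
        mixtureExponent (fun k => ε (i + 1 + k * d) ω - noiseMean μ ε d (i + 1 + k * d) ω)
          (fun k => X (i + 1 + k * d) ω) θ₀ θ n ≤
        ρ / 2 * B ^ 2 + p / 2 * Real.log ((n + ρ) / ρ) + Real.log (d / δ) := by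
  have hd0 : (0 : ℝ) < d := by exact_mod_cast hd
  set bad : ℕ → Set Ω := fun i => {ω | ∃ n ≤ N,
    ∃ θ ∈ Metric.closedBall (0 : EuclideanSpace ℝ (Fin p)) B,
      ρ / 2 * B ^ 2 + p / 2 * Real.log ((n + ρ) / ρ) + Real.log (1 / (δ / d)) <
        mixtureExponent (fun k => ε (i + 1 + k * d) ω - noiseMean μ ε d (i + 1 + k * d) ω)
          (fun k => X (i + 1 + k * d) ω) θ₀ θ n} with hbad
  have hbadle : ∀ i, μ (bad i) ≤ ENNReal.ofReal (δ / d) := by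
    intro i
    have hs : ∀ k, 1 ≤ i + 1 + k * d := fun k => by omega
    -- The `k`-th round of class `i` is `i + 1 + k * d`, and `𝒢 k` is the information `d` rounds
    -- before it. Thus `𝒢 (k + 1)` is the information at round `i + 1 + k * d` itself, which makes
    -- the arms predictable and the noise adapted.
    refine measure_exists_lt_mixtureExponent_le
      (𝒢 := fun k => noiseSigma ε (i + 1 + k * d - d))
      (ξ := fun k ω => ε (i + 1 + k * d) ω - noiseMean μ ε d (i + 1 + k * d) ω)
      (x := fun k => X (i + 1 + k * d))
      (fun k => noiseSigma_le h.measurable _) ?_ ?_ (fun k => hX _ (hs k))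
      (fun k => hX1 _ (hs k))
      (fun k l A hA => setLIntegral_exp_noise_le h hd (hs k) l hA) θ₀ hρ (by positivity) N
    · intro k k' hk
      refine noiseSigma_mono ε (Nat.sub_le_sub_right ?_ d)
      gcongr
    · intro k
      have hk : i + 1 + (k + 1) * d - d = i + 1 + k * d := by
        rw [add_mul, one_mul, ← add_assoc, Nat.add_sub_cancel]
      rw [hk]
      exact (measurable_noiseSigma (hs k)).sub
        ((measurable_noiseMean d _).mono (noiseSigma_mono ε (Nat.sub_le _ _)) le_rfl)
  have hmean : ∀ᵐ ω ∂μ, ∀ s, 1 ≤ s → |noiseMean μ ε d s ω| ≤ φ d :=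
    
    ae_all_iff.2 fun _ => eventually_imp_distrib_left.2 fun hs => abs_noiseMean_le h hd hs
  refine ⟨{ω | ¬ ∀ s, 1 ≤ s → |noiseMean μ ε d s ω| ≤ φ d} ∪ ⋃ i ∈ Finset.range d, bad i,
    ?_, ?_⟩
  · refine (measure_union_le _ _).trans ?_
    rw [ae_iff.1 hmean, zero_add]
    refine (measure_biUnion_finset_le _ _).trans ((Finset.sum_le_sum fun i _ => hbadle i).trans ?_)
    rw [Finset.sum_const, Finset.card_range, nsmul_eq_mul, ← ENNReal.ofReal_natCast,
      ← ENNReal.ofReal_mul hd0.le, mul_div_cancel₀ _ hd0.ne']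
  · intro ω hω
    rw [Set.mem_union, not_or] at hω
    refine ⟨not_not.1 hω.1, fun i hi n hn θ hθ => ?_⟩
    by_contra! hlt
    refine hω.2 (Set.mem_biUnion (Finset.mem_coe.2 (Finset.mem_range.2 hi)) ⟨n, hn, θ, hθ, ?_⟩)
    rwa [one_div_div]

end Noise

/-! ### The confidence sets contain the parameter -/

section Confidence

/-- The number of terms comes from `i + 1 + k * d ≤ t ↔ (k + 1) * d ≤ t + d - 1 - i`; since `i < d`,
the subtraction does not truncate. -/
lemma sum_Icc_eq_sum_residues (F : ℕ → ℝ) (t : ℕ) {d : ℕ} (hd : 1 ≤ d) :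
    ∑ s ∈ Finset.Icc 1 t, F s =
      ∑ i ∈ Finset.range d, ∑ k ∈ Finset.range ((t + d - 1 - i) / d), F (i + 1 + k * d) := by
  rw [Finset.sum_sigma']
  refine Finset.sum_bij' (fun s _ => ⟨(s - 1) % d, (s - 1) / d⟩) (fun a _ => a.1 + 1 + a.2 * d)
    ?_ ?_ ?_ ?_ ?_
  · intro s hs
    have hs' := Finset.mem_Icc.1 hs
    have h1 := Nat.mod_lt (s - 1) hd
    have h2 := Nat.mod_add_div' (s - 1) d
    simp only [Finset.mem_sigma, Finset.mem_range]
    refine ⟨h1, (Nat.le_div_iff_mul_le hd).2 ?_⟩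
    rw [Nat.succ_mul]
    omega
  · rintro ⟨i, k⟩ ha
    simp only [Finset.mem_sigma, Finset.mem_range] at ha
    have h1 := (Nat.le_div_iff_mul_le hd).1 ha.2
    rw [Nat.succ_mul] at h1
    exact Finset.mem_Icc.2 ⟨by simp only; omega, by simp only; omega⟩
  · intro s hs
    have hs' := Finset.mem_Icc.1 hs
    have h2 := Nat.mod_add_div' (s - 1) d
    simp only
    omega
  · rintro ⟨i, k⟩ ha
    simp only [Finset.mem_sigma, Finset.mem_range] at ha
    have h0 : i + 1 + k * d - 1 = i + k * d := by omega
    simp only [h0]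
    rw [Nat.add_mul_mod_self_right, Nat.mod_eq_of_lt ha.1, Nat.add_mul_div_right _ _ hd,
      Nat.div_eq_of_lt ha.1, zero_add]
  · intro s hs
    have hs' := Finset.mem_Icc.1 hs
    have h2 := Nat.mod_add_div' (s - 1) d
    congr 1
    simp only
    omega

variable {p : ℕ} {B : ℝ} {x : ℕ → EuclideanSpace ℝ (Fin p)} {y e : ℕ → ℝ} {t : ℕ}
  {θstar θhat : EuclideanSpace ℝ (Fin p)}

/-- First-order optimality of the constrained least-squares estimator. -/
lemma IsLeastSquares.sum_sq_le (h : IsLeastSquares B x (fun s => inner ℝ θstar (x s) + e s) t θhat)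
    (hθ : θstar ∈ Metric.closedBall 0 B) :
    ∑ s ∈ Finset.Icc 1 t, inner ℝ (θhat - θstar) (x s) ^ 2 ≤
      ∑ s ∈ Finset.Icc 1 t, e s * inner ℝ (θhat - θstar) (x s) := by
  set D : ℕ → ℝ := fun s => inner ℝ (θhat - θstar) (x s) with hD
  set P := ∑ s ∈ Finset.Icc 1 t, D s ^ 2 with hP
  set Q := ∑ s ∈ Finset.Icc 1 t, e s * D s with hQ
  have hP0 : 0 ≤ P := Finset.sum_nonneg fun s _ => sq_nonneg _
  -- Compare `θhat` with the point a fraction `α` along the segment to `θstar`, which stays in the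
  -- ball, and divide by `α`.
  have key : ∀ α : ℝ, 0 < α → α ≤ 1 → 2 * (P - Q) ≤ α * P := by
    intro α h0 h1
    have hmem : (1 - α) • θhat + α • θstar ∈ Metric.closedBall (0 : EuclideanSpace ℝ (Fin p)) B :=
      convex_closedBall _ _ h.1 hθ (by linarith) h0.le (by ring)
    have hmin := h.2 hmem
    simp only [Set.mem_ofPred_eq] at hmin
    have e1 : ∀ s, inner ℝ θhat (x s) - (inner ℝ θstar (x s) + e s) = D s - e s := fun s => by
      simp only [hD, inner_sub_left]; ring
    have e2 : ∀ s, inner ℝ ((1 - α) • θhat + α • θstar) (x s) - (inner ℝ θstar (x s) + e s) =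
        (1 - α) * D s - e s := fun s => by
      simp only [hD, inner_sub_left, inner_add_left, real_inner_smul_left]; ring
    simp only [e1, e2] at hmin
    have e3 : ∑ s ∈ Finset.Icc 1 t, ((1 - α) * D s - e s) ^ 2 =
        ∑ s ∈ Finset.Icc 1 t, (D s - e s) ^ 2 - 2 * α * (P - Q) + α ^ 2 * P := by
      rw [hP, hQ, ← Finset.sum_sub_distrib, Finset.mul_sum, Finset.mul_sum,
        ← Finset.sum_sub_distrib, ← Finset.sum_add_distrib]
      exact Finset.sum_congr rfl fun s _ => by ring
    rw [e3] at hmin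
    have : α * (2 * (P - Q)) ≤ α * (α * P) := by nlinarith
    exact le_of_mul_le_mul_left this h0
  by_contra! hlt
  have hPpos : 0 < P + 1 := by linarith
  -- This `α` is small enough that `α * P ≤ P - Q < 2 * (P - Q)`; the denominator `P + 1` cannot
  -- vanish.
  have hα := key (min 1 ((P - Q) / (P + 1))) (lt_min one_pos (div_pos (by linarith) hPpos))
    (min_le_left _ _)
  have h2 : min 1 ((P - Q) / (P + 1)) * P ≤ (P - Q) / (P + 1) * P := by
    gcongr
    exact min_le_right _ _
  have h3 : (P - Q) / (P + 1) * P ≤ P - Q := by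
    rw [div_mul_eq_mul_div, div_le_iff₀ hPpos]
    nlinarith
  linarith

/-- On the event of the deviation inequalities the true parameter lies in the confidence set. -/
lemma mem_confidenceSet {φ : ℕ → ℝ} {δ : ℝ} {d N : ℕ} {m : ℕ → ℝ} (hp : 0 < p) (hB : 0 < B)
    (hd : 1 ≤ d) (hφ : 0 ≤ φ d) (hx : ∀ s, 1 ≤ s → ‖x s‖ ≤ 1)
    (hθ : θstar ∈ Metric.closedBall 0 B)
    (hLS : IsLeastSquares B x (fun s => inner ℝ θstar (x s) + e s) t θhat)
    (hm : ∀ s, 1 ≤ s → |m s| ≤ φ d)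
    (hdev : ∀ i < d, ∀ n ≤ N, ∀ θ ∈ Metric.closedBall (0 : EuclideanSpace ℝ (Fin p)) B,
        mixtureExponent (fun k => e (i + 1 + k * d) - m (i + 1 + k * d))
          (fun k => x (i + 1 + k * d)) θstar θ n ≤
        (p / B ^ 2) / 2 * B ^ 2 + p / 2 * Real.log ((n + p / B ^ 2) / (p / B ^ 2)) +
          Real.log (d / δ))
    (htN : t ≤ N)
    (hslack : (B - 1) * (t * φ d) ≤ d * p / 2 * Real.log ((B + 1) ^ 2 / (1 + B ^ 2))) :
    θstar ∈ confidenceSet φ B (1 / B ^ 2) δ d x θhat t := by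
  refine ⟨hθ, ?_⟩
  have hd0 : (0 : ℝ) < d := by exact_mod_cast hd
  have hp0 : (0 : ℝ) < p := by exact_mod_cast hp
  set v := θhat - θstar with hv
  have hvB : ‖v‖ ≤ 2 * B := by
    have h1 : ‖θhat‖ ≤ B := by simpa using hLS.1
    have h2 : ‖θstar‖ ≤ B := by simpa using hθ
    linarith [norm_sub_le θhat θstar]
  set D : ℕ → ℝ := fun s => inner ℝ v (x s) with hD
  have hfoc : ∑ s ∈ Finset.Icc 1 t, D s ^ 2 ≤ ∑ s ∈ Finset.Icc 1 t, e s * D s := hLS.sum_sq_le hθ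
  have hDB : ∀ s, 1 ≤ s → |D s| ≤ 2 * B := fun s hs => by
    refine (abs_real_inner_le_norm _ _).trans ?_
    nlinarith [hx s hs, norm_nonneg v, norm_nonneg (x s)]
  have hnorm : matrixNormSq (designMatrix (1 / B ^ 2) x t) (θstar - θhat) ≤
      ∑ s ∈ Finset.Icc 1 t, D s ^ 2 + 4 := by
    rw [matrixNormSq_designMatrix, ← neg_sub, norm_neg, ← hv]
    have h1 : 1 / B ^ 2 * ‖v‖ ^ 2 ≤ 4 := by
      rw [one_div_mul_eq_div, div_le_iff₀ (by positivity)]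
      nlinarith [norm_nonneg v]
    simpa [inner_neg_left, hD] using h1
  set M := max ((d : ℝ) * p) ((t : ℝ) + d) / ((d : ℝ) * p) with hM
  have hM1 : 1 ≤ M := (one_le_div (by positivity)).2 (le_max_left _ _)
  have hM2 : ((t : ℝ) + d) / (d * p) ≤ M :=
    div_le_div_of_nonneg_right (le_max_right _ _) (by positivity)
  have hclass : ∀ i ∈ Finset.range d,
      ∑ k ∈ Finset.range ((t + d - 1 - i) / d), ((e (i + 1 + k * d) - m (i + 1 + k * d)) *
        D (i + 1 + k * d) - D (i + 1 + k * d) ^ 2 / 2) ≤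
      p / 2 + p / 2 * Real.log ((1 + B ^ 2) * M) + Real.log (d / δ) := by
    intro i hi
    have hn1 : (t + d - 1 - i) / d ≤ t := by
      refine Nat.lt_succ_iff.1 ((Nat.div_lt_iff_lt_mul hd).2 ?_)
      have : t ≤ t * d := Nat.le_mul_of_pos_right t hd
      rw [Nat.succ_mul]
      omega
    have hn2 : (((t + d - 1 - i) / d : ℕ) : ℝ) ≤ (t + d) / d := by
      refine Nat.cast_div_le.trans ?_
      gcongr
      exact_mod_cast (by omega : t + d - 1 - i ≤ t + d)
    -- The estimator depends on the noise, so uniformity of the deviation bound in `θ` is essential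
    -- here.
    refine (hdev i (Finset.mem_range.1 hi) _ (hn1.trans htN) θhat hLS.1).trans ?_
    rw [show (p : ℝ) / B ^ 2 / 2 * B ^ 2 = p / 2 by field_simp]
    gcongr
    calc _ = 1 + B ^ 2 * ((((t + d - 1 - i) / d : ℕ) : ℝ) / p) := by field_simp; ring
      _ ≤ 1 + B ^ 2 * (((t + d) / d) / p) := by gcongr
      _ = 1 + B ^ 2 * ((t + d) / (d * p)) := by rw [div_div]
      _ ≤ (1 + B ^ 2) * M := by nlinarith [sq_nonneg B]
  have hsum : ∑ s ∈ Finset.Icc 1 t, ((e s - m s) * D s - D s ^ 2 / 2) ≤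
      d * (p / 2 + p / 2 * Real.log ((1 + B ^ 2) * M) + Real.log (d / δ)) := by
    rw [sum_Icc_eq_sum_residues _ t hd]
    refine (Finset.sum_le_sum hclass).trans (le_of_eq ?_)
    rw [Finset.sum_const, Finset.card_range, nsmul_eq_mul]
  have hbias : ∑ s ∈ Finset.Icc 1 t, m s * D s ≤ t * φ d * (2 * B) := by
    refine (Finset.sum_le_card_nsmul _ _ (φ d * (2 * B)) fun s hs => ?_).trans
      (le_of_eq (by simp [mul_assoc]))
    have hs1 := (Finset.mem_Icc.1 hs).1
    calc m s * D s ≤ |m s * D s| := le_abs_self _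
      _ = |m s| * |D s| := abs_mul _ _
      _ ≤ φ d * (2 * B) := mul_le_mul (hm s hs1) (hDB s hs1) (abs_nonneg _) hφ
  have hhalf : 1 / 2 * ∑ s ∈ Finset.Icc 1 t, D s ^ 2 ≤
      ∑ s ∈ Finset.Icc 1 t, ((e s - m s) * D s - D s ^ 2 / 2) +
        ∑ s ∈ Finset.Icc 1 t, m s * D s := by
    have : ∑ s ∈ Finset.Icc 1 t, ((e s - m s) * D s - D s ^ 2 / 2) +
        ∑ s ∈ Finset.Icc 1 t, m s * D s =
        ∑ s ∈ Finset.Icc 1 t, e s * D s - 1 / 2 * ∑ s ∈ Finset.Icc 1 t, D s ^ 2 := by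
      rw [Finset.mul_sum, ← Finset.sum_add_distrib, ← Finset.sum_sub_distrib]
      exact Finset.sum_congr rfl fun s _ => by ring
    rw [this]
    linarith
  -- The bias costs `2B · t φ d`, but the radius allots only `(B + 1) t φ d`. The missing `(B - 1) t
  -- φ d` is paid, through `hslack`, by the surplus `(B + 1)² / (1 + B²)` inside the logarithm.
  have hlog : Real.log ((B + 1) ^ 2 * Real.exp 1 * max ((d : ℝ) * p) ((t : ℝ) + d) /
      ((d : ℝ) * p)) = Real.log ((B + 1) ^ 2 / (1 + B ^ 2)) + 1 + Real.log ((1 + B ^ 2) * M) := by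
    have hfac : (B + 1) ^ 2 * Real.exp 1 * max ((d : ℝ) * p) ((t : ℝ) + d) / ((d : ℝ) * p) =
        (B + 1) ^ 2 / (1 + B ^ 2) * Real.exp 1 * ((1 + B ^ 2) * M) := by
      rw [hM]
      field_simp
    rw [hfac, Real.log_mul (by positivity) (by positivity),
      Real.log_mul (by positivity) (by positivity), Real.log_exp]
  have hlam : 2 * (1 / B ^ 2) * B ^ 2 = 2 := by field_simp
  rw [hlog, hlam]
  nlinarith

end Confidence

/-! ### Optimism, the gap and the regret bound -/

section Regret

variable {p : ℕ}

/-- The squared radius of the confidence set. -/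
noncomputable def confidenceRadius (p : ℕ) (φ : ℕ → ℝ) (B lam δ : ℝ) (d t : ℕ) : ℝ :=
  (d : ℝ) * p / 2 *
      Real.log ((B + 1) ^ 2 * Real.exp 1 * max ((d : ℝ) * p) ((t : ℝ) + d) / ((d : ℝ) * p))
    + 2 * lam * B ^ 2 + t * φ d * (B + 1) + d * Real.log (d / δ)

variable {B lam δ Δ : ℝ} {φ : ℕ → ℝ} {d T t : ℕ} {x : ℕ → EuclideanSpace ℝ (Fin p)}
  {θstar θhat : EuclideanSpace ℝ (Fin p)} {𝒳 : ℕ → Set (EuclideanSpace ℝ (Fin p))}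

lemma matrixNormSq_sub_le (a b : EuclideanSpace ℝ (Fin p)) (hlam : 0 < lam) :
    matrixNormSq (designMatrix lam x t) (a - b) ≤
      2 * matrixNormSq (designMatrix lam x t) a + 2 * matrixNormSq (designMatrix lam x t) b := by
  simp only [matrixNormSq_designMatrix]
  have h1 : ∑ s ∈ Finset.Icc 1 t, inner ℝ (a - b) (x s) ^ 2 ≤
      2 * ∑ s ∈ Finset.Icc 1 t, inner ℝ a (x s) ^ 2 +
        2 * ∑ s ∈ Finset.Icc 1 t, inner ℝ b (x s) ^ 2 := by
    rw [Finset.mul_sum, Finset.mul_sum, ← Finset.sum_add_distrib]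
    refine Finset.sum_le_sum fun s _ => ?_
    rw [inner_sub_left]
    nlinarith [sq_nonneg (inner ℝ a (x s) + inner ℝ b (x s))]
  have h2 : ‖a - b‖ ^ 2 ≤ 2 * ‖a‖ ^ 2 + 2 * ‖b‖ ^ 2 := by
    have := norm_sub_le a b
    nlinarith [sq_nonneg (‖a‖ - ‖b‖), norm_nonneg (a - b)]
  nlinarith [mul_le_mul_of_nonneg_left h2 hlam.le]

/-- Optimism: the squared instantaneous regret of an arm maximising the upper confidence bound is
controlled by the width of the confidence set in the direction of that arm. -/
lemma sq_inner_sub_le_of_isMaxOn_ucb (hlam : 0 < lam) {A : Set (EuclideanSpace ℝ (Fin p))}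
    (hA : A ⊆ Metric.closedBall 0 1) (hθ : θstar ∈ confidenceSet φ B lam δ d x θhat t)
    {a z : EuclideanSpace ℝ (Fin p)} (ha : a ∈ A)
    (hmax : IsMaxOn (ucb (confidenceSet φ B lam δ d x θhat t)) A z)
    (h0 : 0 ≤ inner ℝ (a - z) θstar) :
    inner ℝ (a - z) θstar ^ 2 ≤ 8 * confidenceRadius p φ B lam δ d t *
      (z.ofLp ⬝ᵥ ((designMatrix lam x t)⁻¹ *ᵥ z.ofLp)) := by
  set V := designMatrix lam x t with hV
  have hVpos : V.PosDef := designMatrix_posDef hlam t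
  set q := z.ofLp ⬝ᵥ (V⁻¹ *ᵥ z.ofLp) with hq
  set β := confidenceRadius p φ B lam δ d t with hβ
  set S := confidenceSet φ B lam δ d x θhat t with hS
  have hq0 : 0 ≤ q := quadForm_nonneg hVpos.inv.posSemidef _
  have hrad : ∀ θ ∈ S, 1 / 2 * matrixNormSq V (θ - θhat) ≤ β := fun θ h => h.2
  have hnn : ∀ u, 0 ≤ matrixNormSq V u := fun u => quadForm_nonneg hVpos.posSemidef u.ofLp
  have hβ0 : 0 ≤ β := (mul_nonneg (by norm_num) (hnn _)).trans (hrad θstar hθ)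
  have hwidth : ∀ θ ∈ S, inner ℝ z θ ≤ inner ℝ z θstar + Real.sqrt (8 * β * q) := by
    intro θ hθS
    -- Both `θ` and `θstar` are within squared distance `2β` of the centre, and `‖a - b‖² ≤ 2‖a‖² +
    -- 2‖b‖²`.
    have h1 : matrixNormSq V (θ - θstar) ≤ 8 * β := by
      have h := matrixNormSq_sub_le (x := x) (t := t) (θ - θhat) (θstar - θhat) hlam
      rw [sub_sub_sub_cancel_right, ← hV] at h
      linarith [hrad θ hθS, hrad θstar hθ]
    have h2 : inner ℝ z (θ - θstar) ^ 2 ≤ 8 * β * q := by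
      rw [← dotProduct_eq_inner]
      refine (sq_dotProduct_le_quadForm_inv_mul hVpos _ _).trans ?_
      rw [mul_comm]
      exact mul_le_mul_of_nonneg_right h1 hq0
    have h3 := Real.le_sqrt_of_sq_le h2
    rw [inner_sub_right] at h3
    linarith
  have hbdd : BddAbove ((fun θ => inner ℝ a θ) '' S) := by
    refine ⟨B, ?_⟩
    rintro _ ⟨θ, hθS, rfl⟩
    have h1 : ‖a‖ ≤ 1 := by simpa using hA ha
    have h2 : ‖θ‖ ≤ B := by simpa using hθS.1
    refine (real_inner_le_norm a θ).trans ?_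
    nlinarith [norm_nonneg a, norm_nonneg θ]
  have h1 : inner ℝ a θstar ≤ ucb S a := le_csSup hbdd ⟨θstar, hθ, rfl⟩
  have h2 : ucb S a ≤ ucb S z := hmax ha
  have h3 : ucb S z ≤ inner ℝ z θstar + Real.sqrt (8 * β * q) := by
    refine csSup_le ⟨_, θstar, hθ, rfl⟩ ?_
    rintro _ ⟨θ, hθS, rfl⟩
    exact hwidth θ hθS
  have h4 : inner ℝ (a - z) θstar ≤ Real.sqrt (8 * β * q) := by
    rw [inner_sub_left]; linarith
  calc inner ℝ (a - z) θstar ^ 2 ≤ Real.sqrt (8 * β * q) ^ 2 := by gcongr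
    _ = 8 * β * q := Real.sq_sqrt (by positivity)

/-- Under a gap the instantaneous regret is attained, and is either zero or at least the gap. -/
lemma HasGap.exists_regret_eq (h : HasGap θstar 𝒳 T Δ) (hΔ : 0 < Δ) (ht : t ∈ Finset.Icc 1 T)
    {z : EuclideanSpace ℝ (Fin p)} (hz : z ∈ 𝒳 t) :
    ∃ a ∈ 𝒳 t, sSup ((fun u => inner ℝ u θstar - inner ℝ z θstar) '' 𝒳 t) =
      inner ℝ (a - z) θstar ∧ 0 ≤ inner ℝ (a - z) θstar ∧
      Δ * inner ℝ (a - z) θstar ≤ inner ℝ (a - z) θstar ^ 2 := by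
  obtain ⟨a, ha, hgap⟩ := h t ht
  refine ⟨a, ha, ?_, ?_⟩
  · rw [inner_sub_left]
    refine IsGreatest.csSup_eq ⟨⟨a, ha, rfl⟩, ?_⟩
    rintro _ ⟨u, hu, rfl⟩
    rcases eq_or_ne u a with rfl | hne
    · exact le_rfl
    · have := hgap u hu hne
      rw [inner_sub_left] at this
      simp only
      linarith
  · rcases eq_or_ne z a with rfl | hne
    · simp
    · have := hgap z hz hne
      exact ⟨by linarith, by nlinarith⟩

/-- Gap-dependent regret bound on the event that the confidence sets contain the parameter. -/
lemma gap_mul_regret_le {βmax : ℝ} (hlam : 0 < lam) (hΔ : 0 < Δ)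
    (hθ : θstar ∈ Metric.closedBall 0 B) (h𝒳 : ∀ t, 1 ≤ t → 𝒳 t ⊆ Metric.closedBall 0 1)
    (hgap : HasGap θstar 𝒳 T Δ) (hx : ∀ t, 1 ≤ t → x t ∈ 𝒳 t)
    {θhat : ℕ → EuclideanSpace ℝ (Fin p)}
    (hmax : ∀ t, d < t → IsMaxOn (ucb (confidenceSet φ B lam δ d x (θhat (t - d)) (t - d)))
      (𝒳 t) (x t))
    (hconf : ∀ t, 1 ≤ t → t ≤ T → θstar ∈ confidenceSet φ B lam δ d x (θhat t) t)
    (hβ : ∀ t, t ≤ T → confidenceRadius p φ B lam δ d t ≤ βmax) (hβ0 : 0 ≤ βmax) (hdT : d ≤ T) :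
    Δ * regret θstar 𝒳 x T ≤ d * (4 * B ^ 2) + 8 * βmax *
      (Real.log (p.factorial * (lam + T) ^ p) - p * Real.log lam + d * (p / lam)) := by
  have hx1 : ∀ t, 1 ≤ t → ‖x t‖ ≤ 1 := fun t ht => by simpa using h𝒳 t ht (hx t ht)
  set r : ℕ → ℝ := fun t => sSup ((fun a => inner ℝ a θstar - inner ℝ (x t) θstar) '' 𝒳 t) with hr
  -- The first `d` arms are arbitrary, with regret at most `2B`. Applying `Δ r ≤ r²` here too keeps
  -- the bound on `Δ * regret` free of `Δ`, hence `T₀` independent of the gap.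
  have hearly : ∀ t ∈ Finset.range d, Δ * r (t + 1) ≤ 4 * B ^ 2 := by
    intro t ht
    have ht' := Finset.mem_range.1 ht
    obtain ⟨a, ha, heq, h0, hsq⟩ := hgap.exists_regret_eq hΔ
      (Finset.mem_Icc.2 ⟨by omega, by omega⟩ : t + 1 ∈ Finset.Icc 1 T) (hx (t + 1) (by omega))
    rw [hr]
    simp only [heq]
    refine hsq.trans ?_
    have h1 : ‖a‖ ≤ 1 := by simpa using h𝒳 (t + 1) (by omega) ha
    have h2 : ‖θstar‖ ≤ B := by simpa using hθ
    have h3 : inner ℝ (a - x (t + 1)) θstar ≤ 2 * B := by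
      refine (real_inner_le_norm _ _).trans ?_
      have := norm_sub_le a (x (t + 1))
      have := hx1 (t + 1) (by omega)
      nlinarith [norm_nonneg (a - x (t + 1)), norm_nonneg θstar]
    nlinarith
  have hlate : ∀ j ∈ Finset.range (T - d), Δ * r (j + 1 + d) ≤ 8 * βmax *
      ((x (j + 1 + d)).ofLp ⬝ᵥ ((designMatrix lam x (j + 1))⁻¹ *ᵥ (x (j + 1 + d)).ofLp)) := by
    intro j hj
    have hj' := Finset.mem_range.1 hj
    obtain ⟨a, ha, heq, h0, hsq⟩ := hgap.exists_regret_eq hΔ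
      (Finset.mem_Icc.2 ⟨by omega, by omega⟩ : j + 1 + d ∈ Finset.Icc 1 T)
      (hx (j + 1 + d) (by omega))
    rw [hr]
    simp only [heq]
    have hm := hmax (j + 1 + d) (by omega)
    rw [Nat.add_sub_cancel] at hm
    refine hsq.trans ((sq_inner_sub_le_of_isMaxOn_ucb hlam (h𝒳 _ (by omega))
      (hconf (j + 1) (by omega) (by omega)) ha hm h0).trans ?_)
    refine mul_le_mul_of_nonneg_right ?_
      (quadForm_nonneg (designMatrix_posDef hlam _).inv.posSemidef _)
    linarith [hβ (j + 1) (by omega)]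
  have hsplit : ∑ t ∈ Finset.Icc 1 T, r t =
      ∑ t ∈ Finset.range d, r (t + 1) + ∑ j ∈ Finset.range (T - d), r (j + 1 + d) := by
    have h1 : ∑ t ∈ Finset.Icc 1 T, r t = ∑ t ∈ Finset.range T, r (t + 1) := by
      rw [Finset.range_eq_Ico, Finset.sum_Ico_add' r 0 T 1]
      rfl
    have h2 := Finset.sum_range_add (fun t => r (t + 1)) d (T - d)
    rw [Nat.add_sub_cancel' hdT] at h2
    rw [h1, h2]
    congr 1
    exact Finset.sum_congr rfl fun j _ => by rw [show d + j + 1 = j + 1 + d by omega]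
  have hpot := sum_delayed_potential_le hlam hx1 d (T - d)
  rw [Nat.sub_add_cancel hdT] at hpot
  rw [regret, show (∑ t ∈ Finset.Icc 1 T, sSup ((fun a => inner ℝ a θstar -
    inner ℝ (x t) θstar) '' 𝒳 t)) = ∑ t ∈ Finset.Icc 1 T, r t from rfl, hsplit, mul_add,
    Finset.mul_sum, Finset.mul_sum]
  refine add_le_add ?_ ?_
  · refine (Finset.sum_le_sum hearly).trans ?_
    simp
  · refine (Finset.sum_le_sum hlate).trans ?_
    rw [← Finset.mul_sum]
    exact mul_le_mul_of_nonneg_left hpot (by positivity)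

/-- High-probability gap-dependent regret bound for Mixing-LinUCB. -/
lemma regret_le_with_high_probability {Ω : Type*} [MeasurableSpace Ω] {μ : Measure Ω}
    [IsProbabilityMeasure μ] {ε : ℕ → Ω → ℝ} {X : ℕ → Ω → EuclideanSpace ℝ (Fin p)} {βmax : ℝ}
    (hp : 0 < p) (hB : 0 < B) (hδ : 0 < δ) (hΔ : 0 < Δ) (hd : 1 ≤ d) (hdT : d ≤ T)
    (hε : IsMixingSubGaussian μ 1 φ ε)
    (hθ : θstar ∈ Metric.closedBall 0 B) (h𝒳 : ∀ t, 1 ≤ t → 𝒳 t ⊆ Metric.closedBall 0 1)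
    (hgap : HasGap θstar 𝒳 T Δ) (hX : IsMixingLinUCB ε θstar 𝒳 φ B (1 / B ^ 2) δ d X)
    (hslack : ∀ t : ℕ, t ≤ T →
      (B - 1) * (t * φ d) ≤ d * p / 2 * Real.log ((B + 1) ^ 2 / (1 + B ^ 2)))
    (hβ : ∀ t, t ≤ T → confidenceRadius p φ B (1 / B ^ 2) δ d t ≤ βmax) (hβ0 : 0 ≤ βmax) :
    1 - δ ≤ μ.real {ω | Δ * regret θstar 𝒳 (fun t => X t ω) T ≤ d * (4 * B ^ 2) + 8 * βmax *
      (Real.log (p.factorial * (1 / B ^ 2 + T) ^ p) - p * Real.log (1 / B ^ 2) +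
        d * (p / (1 / B ^ 2)))} := by
  have hX1 : ∀ t, 1 ≤ t → ∀ ω, ‖X t ω‖ ≤ 1 := fun t ht ω => by
    simpa using h𝒳 t ht (hX.mem t ht ω)
  have hρ : (0 : ℝ) < p / B ^ 2 := by positivity
  obtain ⟨S, hS, hgood⟩ := exists_measure_le_forall_mixtureExponent_le (B := B) hε hd hX.adapted hX1
    θstar hρ hδ T
  obtain ⟨θhat, hLS, hopt⟩ := hX.optimistic
  set G := {ω | Δ * regret θstar 𝒳 (fun t => X t ω) T ≤ d * (4 * B ^ 2) + 8 * βmax *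
      (Real.log (p.factorial * (1 / B ^ 2 + T) ^ p) - p * Real.log (1 / B ^ 2) +
        d * (p / (1 / B ^ 2)))} with hG
  have hsub : Set.univ ⊆ G ∪ S := by
    intro ω _
    by_cases hω : ω ∈ S
    · exact Or.inr hω
    · obtain ⟨hmean, hdev⟩ := hgood ω hω
      have hconf : ∀ t, 1 ≤ t → t ≤ T → θstar ∈
          confidenceSet φ B (1 / B ^ 2) δ d (fun s => X s ω) (θhat t ω) t := fun t ht htT =>
        mem_confidenceSet hp hB hd (hε.coeff_nonneg d) (fun s hs => hX1 s hs ω) hθ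
          (hLS t ht ω) hmean hdev htT (hslack t htT)
      have hlam : 0 < 1 / B ^ 2 := by positivity
      exact Or.inl (gap_mul_regret_le (x := fun t => X t ω) (θhat := fun t => θhat t ω) hlam hΔ hθ
        h𝒳 hgap (fun t ht => hX.mem t ht ω) (fun t ht => hopt t ht ω) hconf hβ hβ0 hdT)
  -- Subadditivity on the cover `G ∪ S` suffices; measurability of `G` is not needed.
  have h1 : (1 : ENNReal) ≤ μ G + ENNReal.ofReal δ := by
    rw [← measure_univ (μ := μ)]
    exact (measure_mono hsub).trans ((measure_union_le _ _).trans (by gcongr))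
  have h2 : μ G = ENNReal.ofReal (μ.real G) := (ofReal_measureReal).symm
  rw [h2, ← ENNReal.ofReal_add measureReal_nonneg hδ.le, ENNReal.one_le_ofReal] at h1
  linarith

end Regret

/-! ### Large horizons and comparison with the rate -/

section Asymptotics

variable {p : ℕ} {B C τ δ Δ : ℝ}

/-- Write `Q` for the bracket in the rate. The two logarithmic terms give at most `2dQ`, the
regularisation and bias at most `dQ`, and `d ≤ 2τL` turns `3dQ` into `6τLQ`. The bound `1 ≤ Q` uses
only `τL ≥ 3 > e` and `δ < 1`, so no threshold depends on `δ`. -/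
lemma confidenceRadius_le {φ : ℕ → ℝ} {d t T : ℕ} {L : ℝ} (hp : 0 < p) (hB : 0 < B) (hτ : 0 < τ)
    (hδ : 0 < δ) (hδ1 : δ < 1) (hd : τ * L ≤ d) (hd2 : (d : ℝ) ≤ 2 * (τ * L)) (hdT : d ≤ T)
    (htT : t ≤ T) (hφ0 : 0 ≤ φ d) (hφ : T * φ d ≤ p / B) (hL3 : 3 ≤ τ * L)
    (hL : 2 + p * (B + 1) / B ≤ τ * L) (hTp : p * τ ≤ T) (hT1 : 1 ≤ T)
    (hT : 3 * ((B + 1) ^ 2 * Real.exp 1) * (p * τ) ^ 2 ≤ T) :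
    1 ≤ p / 2 * Real.log (T / (p * τ)) + Real.log (τ * L / δ) ∧
    confidenceRadius p φ B (1 / B ^ 2) δ d t ≤
      6 * (τ * L) * (p / 2 * Real.log (T / (p * τ)) + Real.log (τ * L / δ)) := by
  have hp0 : (1 : ℝ) ≤ p := by exact_mod_cast hp
  have hT0 : (1 : ℝ) ≤ T := by exact_mod_cast hT1
  have hd1 : (3 : ℝ) ≤ d := hL3.trans hd
  have hdT' : (d : ℝ) ≤ T := by exact_mod_cast hdT
  have htT' : (t : ℝ) ≤ T := by exact_mod_cast htT
  have hpτ : 0 < p * τ := by positivity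
  have hlogT : 0 ≤ Real.log (T / (p * τ)) := Real.log_nonneg ((one_le_div hpτ).2 hTp)
  have hδL : τ * L ≤ τ * L / δ := by
    rw [le_div_iff₀ hδ]; nlinarith
  have hlogL : 1 ≤ Real.log (τ * L / δ) := by
    rw [Real.le_log_iff_exp_le (by linarith)]
    linarith [Real.exp_one_lt_three]
  have hQ : 1 ≤ p / 2 * Real.log (T / (p * τ)) + Real.log (τ * L / δ) := by
    nlinarith
  refine ⟨hQ, ?_⟩
  have hlog2 : ∀ y : ℝ, 2 * Real.log y = Real.log (y ^ 2) := fun y => by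
    rw [Real.log_pow, Nat.cast_ofNat]
  have h1 : Real.log ((B + 1) ^ 2 * Real.exp 1 * max ((d : ℝ) * p) ((t : ℝ) + d) /
      ((d : ℝ) * p)) ≤ 2 * Real.log (T / (p * τ)) := by
    have hM0 : (0 : ℝ) < max ((d : ℝ) * p) ((t : ℝ) + d) := lt_max_of_lt_left (by positivity)
    have hM : max ((d : ℝ) * p) ((t : ℝ) + d) / ((d : ℝ) * p) ≤ 3 * T := by
      rw [div_le_iff₀ (by positivity)]
      have hdp : 1 ≤ (d : ℝ) * p := by nlinarith
      exact max_le (by nlinarith) (by nlinarith)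
    rw [hlog2, mul_div_assoc]
    refine Real.log_le_log (by positivity) ?_
    calc _ ≤ (B + 1) ^ 2 * Real.exp 1 * (3 * T) := by gcongr
      _ ≤ (T / (p * τ)) ^ 2 := by
        rw [div_pow, le_div_iff₀ (by positivity)]
        nlinarith
  have h2 : Real.log (d / δ) ≤ 2 * Real.log (τ * L / δ) := by
    rw [hlog2]
    refine Real.log_le_log (by positivity) ?_
    calc (d : ℝ) / δ ≤ 2 * (τ * L) / δ := by gcongr
      _ = 2 * (τ * L / δ) := by ring
      _ ≤ (τ * L / δ) ^ 2 := by nlinarith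
  have h3 : t * φ d * (B + 1) ≤ p * (B + 1) / B := by
    have : t * φ d ≤ p / B := (mul_le_mul_of_nonneg_right htT' hφ0).trans hφ
    calc t * φ d * (B + 1) ≤ p / B * (B + 1) := by gcongr
      _ = p * (B + 1) / B := by ring
  have h4 : 2 * (1 / B ^ 2) * B ^ 2 = 2 := by field_simp
  set P := Real.log (T / (p * τ))
  set R := Real.log (τ * L / δ)
  have h5 : (d : ℝ) * p / 2 * Real.log ((B + 1) ^ 2 * Real.exp 1 *
      max ((d : ℝ) * p) ((t : ℝ) + d) / ((d : ℝ) * p)) ≤ d * p / 2 * (2 * P) := by gcongr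
  have h6 : (d : ℝ) * Real.log (d / δ) ≤ d * (2 * R) := by gcongr
  have h7 : 2 + p * (B + 1) / B ≤ d * (p / 2 * P + R) :=
    hL.trans (hd.trans (le_mul_of_one_le_right (by positivity) hQ))
  rw [confidenceRadius, h4]
  have h8 : (d : ℝ) * (p / 2 * P + R) ≤ 2 * (τ * L) * (p / 2 * P + R) := by gcongr
  nlinarith

lemma tendsto_log_mul_natCast {c : ℝ} (hc : 0 < c) :
    Tendsto (fun T : ℕ => Real.log (c * T)) atTop atTop :=
  Real.tendsto_log_atTop.comp (tendsto_natCast_atTop_atTop.const_mul_atTop hc)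

lemma eventually_log_mul_le {c : ℝ} (hc : 0 < c) :
    ∀ᶠ T : ℕ in atTop, Real.log (c * T) ≤ 2 * Real.log T := by
  have h := tendsto_log_mul_natCast one_pos
  filter_upwards [h.eventually_ge_atTop (Real.log c), eventually_ge_atTop 1] with T h1 hT
  have hT0 : (0 : ℝ) < T := by exact_mod_cast hT
  rw [one_mul] at h1
  rw [Real.log_mul hc.ne' hT0.ne']
  linarith

lemma eventually_mul_log_le_sqrt (k : ℝ) :
    ∀ᶠ T : ℕ in atTop, k * Real.log T ≤ Real.sqrt T := by
  have h := (isLittleO_log_rpow_atTop (half_pos one_pos)).bound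
    (show (0 : ℝ) < 1 / (|k| + 1) by positivity)
  filter_upwards [tendsto_natCast_atTop_atTop.eventually h, eventually_ge_atTop 1] with T hT hT1
  have hlog : 0 ≤ Real.log T := Real.log_natCast_nonneg T
  rw [Real.norm_of_nonneg hlog, Real.norm_of_nonneg (by positivity), ← Real.sqrt_eq_rpow,
    one_div_mul_eq_div, le_div_iff₀ (by positivity)] at hT
  nlinarith [le_abs_self k]

lemma eventually_horizon_conditions (hp : 0 < p) (hB : 0 < B) (hC : 0 < C) (hτ : 0 < τ) (K : ℝ) :
    ∀ᶠ T : ℕ in atTop, K ≤ Real.log (B * C * T / p) ∧ K ≤ T ∧ 1 ≤ T ∧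
      1 ≤ Real.log T ∧ Real.log (B * C * T / p) ≤ 2 * Real.log T ∧
      2 * (τ * Real.log (B * C * T / p)) ≤ T ∧
      1 / 2 * Real.log T ≤ Real.log (1 + B ^ 2 * T / (p * τ * Real.log (B * C * T / p))) := by
  have hp0 : (0 : ℝ) < p := by exact_mod_cast hp
  have hc : 0 < B * C / p := by positivity
  have hlog1 := tendsto_log_mul_natCast one_pos
  filter_upwards [(tendsto_log_mul_natCast hc).eventually_ge_atTop K,
    (tendsto_log_mul_natCast hc).eventually_gt_atTop 0,
    tendsto_natCast_atTop_atTop.eventually_ge_atTop K, eventually_ge_atTop 1,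
    hlog1.eventually_ge_atTop 1, eventually_log_mul_le hc,
    eventually_mul_log_le_sqrt (4 * τ), eventually_mul_log_le_sqrt (2 * (p * τ) / B ^ 2)]
    with T h1 h2 h3 h4 h5 h6 h7 h8
  rw [one_mul] at h5
  rw [mul_div_right_comm]
  set L := Real.log (B * C / p * T)
  have hT0 : (1 : ℝ) ≤ T := by exact_mod_cast h4
  have hsq : Real.sqrt T ^ 2 = T := Real.sq_sqrt (by linarith)
  have hs1 : 1 ≤ Real.sqrt T := Real.one_le_sqrt.2 hT0
  refine ⟨h1, h3, h4, h5, h6, ?_, ?_⟩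
  · nlinarith
  -- Since `L` is only logarithmic in `T`, `p τ L ≤ B² √T` eventually.
  · have h9 : Real.sqrt T ≤ B ^ 2 * T / (p * τ * L) := by
      rw [le_div_iff₀ (by positivity)]
      rw [div_mul_eq_mul_div, div_le_iff₀ (by positivity)] at h8
      have h10 : p * τ * L ≤ Real.sqrt T * B ^ 2 := by
        refine le_trans ?_ h8
        nlinarith [mul_pos hp0 hτ]
      nlinarith
    rw [one_div_mul_eq_div, ← Real.log_sqrt (by linarith)]
    exact Real.log_le_log (by linarith) (by linarith)

/-- Comparison of the explicit regret bound with the rate, for large horizons. -/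
lemma eventually_potential_le (hp : 0 < p) (hB : 0 < B) (hC : 0 < C) (hτ : 0 < τ) :
    ∀ᶠ T : ℕ in atTop,
      B ^ 2 + 6 * (Real.log (p.factorial * (1 / B ^ 2 + T) ^ p) - p * Real.log (1 / B ^ 2) +
        2 * (τ * Real.log (B * C * T / p)) * (p / (1 / B ^ 2))) ≤
      p * Real.log (B * C * T / p) *
        Real.log (1 + B ^ 2 * T / (p * τ * Real.log (B * C * T / p))) := by
  have hp0 : (0 : ℝ) < p := by exact_mod_cast hp
  set F := Real.log p.factorial with hF
  have hF0 : 0 ≤ F := Real.log_natCast_nonneg _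
  have hc0 : 0 ≤ Real.log (1 + B ^ 2) := Real.log_nonneg (by nlinarith)
  -- The left side is at most `M log T`, while the right side is at least `p L · (log T) / 2`; hence
  -- the threshold `L ≥ 2M / p`.
  set M := B ^ 2 + 6 * (F + p * (Real.log (1 + B ^ 2) + 1) + 4 * τ * p * B ^ 2) with hM
  have hM0 : 0 ≤ M := by positivity
  filter_upwards [eventually_horizon_conditions hp hB hC hτ (2 * M / p)] with T h
  obtain ⟨h1, -, h3, h4, h5, -, h7⟩ := h
  set L := Real.log (B * C * T / p)
  set Λ := Real.log (1 + B ^ 2 * T / (p * τ * L))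
  have hT0 : (1 : ℝ) ≤ T := by exact_mod_cast h3
  have e1 : Real.log (p.factorial * (1 / B ^ 2 + T) ^ p) - p * Real.log (1 / B ^ 2) =
      F + p * Real.log (1 + B ^ 2 * T) := by
    have : (1 / B ^ 2 + T : ℝ) = 1 / B ^ 2 * (1 + B ^ 2 * T) := by field_simp
    rw [Real.log_mul (by positivity) (by positivity), Real.log_pow, this,
      Real.log_mul (by positivity) (by positivity)]
    ring
  have e2 : (p : ℝ) / (1 / B ^ 2) = p * B ^ 2 := by field_simp
  have e3 : Real.log (1 + B ^ 2 * T) ≤ Real.log (1 + B ^ 2) + Real.log T := by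
    rw [← Real.log_mul (by positivity) (by positivity)]
    exact Real.log_le_log (by positivity) (by nlinarith)
  rw [e1, e2]
  have e4 : Real.log (1 + B ^ 2) ≤ Real.log (1 + B ^ 2) * Real.log T :=
    le_mul_of_one_le_right hc0 h4
  have e5 : F ≤ F * Real.log T := le_mul_of_one_le_right hF0 h4
  have e6 : B ^ 2 ≤ B ^ 2 * Real.log T := le_mul_of_one_le_right (by positivity) h4
  have e7 : p * Real.log (1 + B ^ 2 * T) ≤ p * ((Real.log (1 + B ^ 2) + 1) * Real.log T) := by
    gcongr
    linarith
  have e8 : 2 * (τ * L) * (p * B ^ 2) ≤ 4 * τ * p * B ^ 2 * Real.log T := by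
    have : 0 < τ * (p * B ^ 2) := by positivity
    nlinarith
  have hle : B ^ 2 + 6 * (F + p * Real.log (1 + B ^ 2 * T) + 2 * (τ * L) * (p * B ^ 2)) ≤
      M * Real.log T := by
    rw [hM]
    nlinarith
  refine hle.trans ?_
  have hL : 2 * M ≤ p * L := by
    rw [div_le_iff₀ hp0] at h1
    linarith
  nlinarith [mul_le_mul_of_nonneg_left h7 (show 0 ≤ p * L by linarith)]

/-- This dictates the delay: at `d = τ log (BCT/p)` the accumulated mixing coefficient is exactly `p
/ B`, whatever the horizon. -/
lemma natCast_mul_geometricCoeff_le (hp : 0 < p) (hB : 0 < B) (hC : 0 < C) (hτ : 0 < τ) {T d : ℕ}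
    (hT : 1 ≤ T) (hd : τ * Real.log (B * C * T / p) ≤ d) :
    T * geometricCoeff C τ d ≤ p / B := by
  have hp0 : (0 : ℝ) < p := by exact_mod_cast hp
  have hT0 : (0 : ℝ) < T := by exact_mod_cast hT
  have h1 : Real.exp (-(d : ℝ) / τ) ≤ (B * C * T / p)⁻¹ := by
    rw [← Real.exp_log (show 0 < (B * C * T / p)⁻¹ by positivity), Real.log_inv]
    refine Real.exp_le_exp.2 ?_
    rw [neg_div, neg_le_neg_iff, le_div_iff₀ hτ]
    linarith
  calc T * geometricCoeff C τ d ≤ T * (C * (B * C * T / p)⁻¹) := by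
        rw [geometricCoeff]; gcongr
    _ = p / B := by field_simp

/-- The gap-dependent regret bound, for all sufficiently large horizons. -/
lemma eventually_regret_le (hp : 0 < p) (hB : 0 < B) (hC : 0 < C) (hτ : 0 < τ) :
    ∀ᶠ T : ℕ in atTop, ∀ δ Δ : ℝ, 0 < δ → δ < 1 → 0 < Δ →
      ∀ (Ω : Type*) [MeasurableSpace Ω] (μ : Measure Ω) [IsProbabilityMeasure μ]
        (ε : ℕ → Ω → ℝ) (θstar : EuclideanSpace ℝ (Fin p))
        (𝒳 : ℕ → Set (EuclideanSpace ℝ (Fin p))) (X : ℕ → Ω → EuclideanSpace ℝ (Fin p)),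
        IsMixingSubGaussian μ 1 (geometricCoeff C τ) ε →
        θstar ∈ Metric.closedBall 0 B →
        (∀ t, 1 ≤ t → 𝒳 t ⊆ Metric.closedBall 0 1) →
        HasGap θstar 𝒳 T Δ →
        IsMixingLinUCB ε θstar 𝒳 (geometricCoeff C τ) B (1 / B ^ 2) δ
          ⌈τ * Real.log (B * C * T / p)⌉₊ X →
        1 - δ ≤ μ.real {ω | regret θstar 𝒳 (fun t => X t ω) T ≤
          geometricGapRate p B C τ Δ δ T} := by
  have hp0 : (0 : ℝ) < p := by exact_mod_cast hp
  set κ := Real.log ((B + 1) ^ 2 / (1 + B ^ 2)) with hκ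
  have hκ0 : 0 < κ := Real.log_pos ((one_lt_div (by positivity)).2 (by nlinarith))
  filter_upwards [eventually_potential_le hp hB hC hτ,
    eventually_horizon_conditions hp hB hC hτ (3 / τ),
    eventually_horizon_conditions hp hB hC hτ (2 / κ / τ),
    eventually_horizon_conditions hp hB hC hτ ((2 + p * (B + 1) / B) / τ),
    eventually_horizon_conditions hp hB hC hτ (p * τ),
    eventually_horizon_conditions hp hB hC hτ
      (3 * ((B + 1) ^ 2 * Real.exp 1) * (p * τ) ^ 2)] with T hpot h3 hκL h2 hTp hT
  intro δ Δ hδ hδ1 hΔ Ω _ μ _ ε θstar 𝒳 X hε hθ h𝒳 hgap hX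
  set L := Real.log (B * C * T / p) with hL
  set Λ := Real.log (1 + B ^ 2 * T / (p * τ * L)) with hΛ
  set d := ⌈τ * L⌉₊ with hd
  have hL3 : 3 ≤ τ * L := by
    have := (div_le_iff₀ hτ).1 h3.1
    linarith
  have hL2 : 2 + p * (B + 1) / B ≤ τ * L := by
    have := (div_le_iff₀ hτ).1 h2.1
    linarith
  have hLκ : 2 / κ ≤ τ * L := by
    have := (div_le_iff₀ hτ).1 hκL.1
    linarith
  have hdL : τ * L ≤ d := Nat.le_ceil _
  have hd2 : (d : ℝ) ≤ 2 * (τ * L) := by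
    have := Nat.ceil_lt_add_one (show 0 ≤ τ * L by linarith)
    linarith
  have hd1 : 1 ≤ d := Nat.ceil_pos.2 (by linarith)
  have hT1 : 1 ≤ T := h3.2.2.1
  have hdT : d ≤ T := by
    have h := hd2.trans h3.2.2.2.2.2.1
    exact_mod_cast h
  have hφ0 : 0 ≤ geometricCoeff C τ d := hε.coeff_nonneg d
  have hφ : T * geometricCoeff C τ d ≤ p / B := natCast_mul_geometricCoeff_le hp hB hC hτ hT1 hdL
  set Q := p / 2 * Real.log (T / (p * τ)) + Real.log (τ * L / δ) with hQ
  have hrad : ∀ t ≤ T, 1 ≤ Q ∧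
      confidenceRadius p (geometricCoeff C τ) B (1 / B ^ 2) δ d t ≤ 6 * (τ * L) * Q :=
    fun t ht => confidenceRadius_le hp hB hτ hδ hδ1 hdL hd2 hdT ht hφ0 hφ hL3 hL2 hTp.2.1 hT1
      hT.2.1
  have hQ1 : 1 ≤ Q := (hrad T le_rfl).1
  -- The left side is at most `p`, so `d κ ≥ 2` suffices; this holds for large `T` because `κ > 0`.
  have hslack : ∀ t : ℕ, t ≤ T → (B - 1) * (t * geometricCoeff C τ d) ≤ d * p / 2 * κ := by
    intro t ht
    have ht' : (t : ℝ) * geometricCoeff C τ d ≤ p / B :=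
      (mul_le_mul_of_nonneg_right (by exact_mod_cast ht) hφ0).trans hφ
    have ht0 : 0 ≤ (t : ℝ) * geometricCoeff C τ d := by positivity
    rw [le_div_iff₀ hB] at ht'
    have h5 : 2 ≤ d * κ := (div_le_iff₀ hκ0).1 (hLκ.trans hdL)
    nlinarith
  refine (regret_le_with_high_probability hp hB hδ hΔ hd1 hdT hε hθ h𝒳 hgap hX hslack
    (fun t ht => (hrad t ht).2) (by positivity)).trans ?_
  refine measureReal_mono ?_ (measure_ne_top _ _)
  intro ω hω
  have hω' := Set.mem_ofPred_eq ▸ hω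
  have hgoal : Δ * regret θstar 𝒳 (fun t => X t ω) T ≤
      8 * τ * p * L ^ 2 * Λ * Q := by
    refine le_trans hω' ?_
    set W := Real.log (p.factorial * (1 / B ^ 2 + T) ^ p) - p * Real.log (1 / B ^ 2)
    have hτL : 0 < τ * L := by linarith
    have h6 : (d : ℝ) * (4 * B ^ 2) ≤ 8 * (τ * L) * Q * B ^ 2 := by
      calc (d : ℝ) * (4 * B ^ 2) ≤ 2 * (τ * L) * (4 * B ^ 2) := by gcongr
        _ = 8 * (τ * L) * 1 * B ^ 2 := by ring
        _ ≤ 8 * (τ * L) * Q * B ^ 2 := by gcongr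
    have h7 : 8 * (6 * (τ * L) * Q) * (W + d * (p / (1 / B ^ 2))) ≤
        8 * (6 * (τ * L) * Q) * (W + 2 * (τ * L) * (p / (1 / B ^ 2))) := by gcongr
    -- The common factor `8τLQ` carries all dependence on `δ`; `1 ≤ Q` has let the early rounds
    -- share it.
    have h8 := mul_le_mul_of_nonneg_left hpot (show 0 ≤ 8 * (τ * L) * Q by positivity)
    linarith
  have hrate : geometricGapRate p B C τ Δ δ T = 8 * τ * p * L ^ 2 * Λ * Q / Δ := by
    rw [geometricGapRate]
    ring
  change regret θstar 𝒳 (fun t => X t ω) T ≤ geometricGapRate p B C τ Δ δ T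
  rw [hrate, le_div_iff₀ hΔ]
  linarith

lemma isBigO_log_mul_natCast {c : ℝ} (hc : 0 < c) :
    (fun T : ℕ => Real.log (c * T)) =O[atTop] fun T : ℕ => Real.log T := by
  refine IsBigO.of_bound 2 ?_
  filter_upwards [eventually_log_mul_le hc, (tendsto_log_mul_natCast hc).eventually_ge_atTop 0]
    with T h1 h2
  rw [Real.norm_of_nonneg h2, Real.norm_of_nonneg (Real.log_natCast_nonneg T)]
  exact h1

/-- The rate is polylogarithmic in the horizon. -/
lemma geometricGapRate_isBigO (hp : 0 < p) (hB : 0 < B) (hC : 0 < C) (hτ : 0 < τ) (hδ : 0 < δ) :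
    (fun T : ℕ => geometricGapRate p B C τ Δ δ T) =O[atTop] fun T : ℕ => Real.log T ^ 4 := by
  have hp0 : (0 : ℝ) < p := by exact_mod_cast hp
  have hL : (fun T : ℕ => Real.log (B * C * T / p)) =O[atTop] fun T : ℕ => Real.log T := by
    simp_rw [mul_div_right_comm]
    exact isBigO_log_mul_natCast (by positivity)
  have hΛ : (fun T : ℕ => Real.log (1 + B ^ 2 * T / (p * τ * Real.log (B * C * T / p))))
      =O[atTop] fun T : ℕ => Real.log T := by
    refine IsBigO.trans ?_ (isBigO_log_mul_natCast (show 0 < 1 + B ^ 2 by positivity))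
    refine IsBigO.of_bound 1 ?_
    filter_upwards [eventually_horizon_conditions hp hB hC hτ (1 / (p * τ))] with T h
    have hT : (1 : ℝ) ≤ T := by exact_mod_cast h.2.2.1
    have hpL : 1 ≤ p * τ * Real.log (B * C * T / p) := by
      have := (div_le_iff₀ (by positivity)).1 h.1
      linarith
    have h1 : B ^ 2 * T / (p * τ * Real.log (B * C * T / p)) ≤ B ^ 2 * T :=
      div_le_self (by positivity) hpL
    have h0 : 0 ≤ B ^ 2 * T / (p * τ * Real.log (B * C * T / p)) := by positivity
    rw [one_mul, Real.norm_of_nonneg (Real.log_nonneg (by linarith)),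
      Real.norm_of_nonneg (Real.log_nonneg (by nlinarith))]
    exact Real.log_le_log (by linarith) (by nlinarith)
  have hP : (fun T : ℕ => p / 2 * Real.log (T / (p * τ))) =O[atTop]
      fun T : ℕ => Real.log T := by
    refine IsBigO.const_mul_left ?_ _
    simp_rw [div_eq_inv_mul]
    exact isBigO_log_mul_natCast (by positivity)
  have hR : (fun T : ℕ => Real.log (τ * Real.log (B * C * T / p) / δ)) =O[atTop]
      fun T : ℕ => Real.log T := by
    refine IsBigO.trans ?_ (hL.const_mul_left (τ / δ))
    refine IsBigO.of_bound 1 ?_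
    filter_upwards [eventually_horizon_conditions hp hB hC hτ (δ / τ)] with T h
    have h1 : 1 ≤ τ * Real.log (B * C * T / p) / δ := by
      rw [one_le_div hδ]
      have := (div_le_iff₀ hτ).1 h.1
      linarith
    rw [one_mul, ← mul_div_right_comm, Real.norm_of_nonneg (Real.log_nonneg h1),
      Real.norm_of_nonneg (by linarith)]
    -- This term is doubly logarithmic in `T`, but `log y ≤ y - 1` is enough here.
    linarith [Real.log_le_sub_one_of_pos (show 0 < τ * Real.log (B * C * T / p) / δ by linarith)]
  have h := (((hL.pow 2).const_mul_left (8 * τ * p / Δ)).mul hΛ).mul (hP.add hR)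
  refine h.congr_right fun T => ?_
  ring

end Asymptotics

end MixingBandit

theorem corollary4 :
    -- the regret bound; the constant `K` is universal
    (∃ K : ℝ, 0 < K ∧
      ∀ (p : ℕ) (B C τ : ℝ), 0 < p → 0 < B → 0 < C → 0 < τ →
      ∃ T₀ : ℕ, ∀ T : ℕ, T₀ ≤ T → ∀ δ Δ : ℝ, 0 < δ → δ < 1 → 0 < Δ →
      ∀ (Ω : Type*) [MeasurableSpace Ω] (μ : Measure Ω) [IsProbabilityMeasure μ]
        (ε : ℕ → Ω → ℝ) (θstar : EuclideanSpace ℝ (Fin p))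
        (𝒳 : ℕ → Set (EuclideanSpace ℝ (Fin p))) (X : ℕ → Ω → EuclideanSpace ℝ (Fin p)),
        MixingBandit.IsMixingSubGaussian μ 1 (MixingBandit.geometricCoeff C τ) ε →
        θstar ∈ Metric.closedBall 0 B →
        (∀ t, 1 ≤ t → 𝒳 t ⊆ Metric.closedBall 0 1) →
        MixingBandit.HasGap θstar 𝒳 T Δ →
        MixingBandit.IsMixingLinUCB ε θstar 𝒳 (MixingBandit.geometricCoeff C τ) B (1 / B ^ 2) δ
          ⌈τ * Real.log (B * C * T / p)⌉₊ X →
        1 - δ ≤ μ.real {ω | MixingBandit.regret θstar 𝒳 (fun t => X t ω) T ≤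
          K * MixingBandit.geometricGapRate p B C τ Δ δ T}) ∧
    -- the bound is polylogarithmic in `T`
    (∀ (p : ℕ) (B C τ Δ δ : ℝ), 0 < p → 0 < B → 0 < C → 0 < τ → 0 < Δ → 0 < δ → δ < 1 →
      (fun T : ℕ => MixingBandit.geometricGapRate p B C τ Δ δ T)
        =O[atTop] fun T : ℕ => Real.log T ^ 4) := by
  refine ⟨⟨1, one_pos, fun p B C τ hp hB hC hτ => ?_⟩,
    fun p B C τ Δ δ hp hB hC hτ _ hδ _ => MixingBandit.geometricGapRate_isBigO hp hB hC hτ hδ⟩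
  simp_rw [one_mul]
  exact eventually_atTop.1 (MixingBandit.eventually_regret_le hp hB hC hτ)
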